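/- Let $k$ be a field of characteristic zero, $d\ge 3$, $R=k[x_1,\dots,x_d]$ and $\mathfrak m=(x_1,\dots,x_d)$. Let $I=(f_1,\dots,f_{d+1})\subset R$ be a perfect ideal of height two, minimally generated by $d+1$ homogeneous elements $f_1,\dots,f_{d+1}$ of the same degree $\nu$, and suppose that $I$ satisfies $G_d$, that is, $\mu(I_{\mathfrak p})\le\dim R_{\mathfrak p}$ for every prime $\mathfrak p\supseteq I$ with $\mathfrak p\ne\mathfrak m$, where $\mu$ denotes the minimal number of generators. Let $\varphi=(a_{i,j})$ be a $(d+1)\times d$ matrix over $R$ such that $$0\to R^{d}\xrightarrow{\ \varphi\ }R^{d+1}\xrightarrow{[f_1,\dots,f_{d+1}]}I\to 0$$ is exact and such that all entries $a_{1,j},\dots,a_{d+1,j}$ of the $j$-th column are homogeneous of degree $\nu_j$ $(1\le j\le d)$. Let $S=R[T_1,\dots,T_{d+1}]$, bigraded by $\operatorname{bideg}T_i=(1,0)$ and $\operatorname{bideg}x_j=(0,1)$, and put $g_j=\sum_{i=1}^{d+1}a_{i,j}T_i\in S$, so that $\operatorname{bideg}g_j=(1,\nu_j)$. Let $\mathcal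 K$ be the kernel of the canonical map $\operatorname{Sym}(I)\to\mathcal R(I)=\bigoplus_{i\ge 0}I^it^i$ from the symmetric algebra to the Rees algebra, regarded as a bigraded $S$-module through the surjection $S\to\operatorname{Sym}(I)$, $T_i\mapsto f_i$; that is, $\mathcal K_{p,q}$ is the intersection of $\mathcal K$ with the image of $S_{p,q}$. Let $H^2_{\mathfrak m}(S/(g_1,\dots,g_{d-2}))$ be the second local cohomology module with support in $\mathfrak m$, with its natural bigrading (computed from the Čech complex on $x_1,\dots,x_d$), and write $M(a,b)_{p,q}=M_{p+a,q+b}$. Then there is an isomorphism of bigraded $S$-modules $$\mathcal K\;\cong\;\Big\{\,w\in H^2_{\mathfrak m}\Big(\frac{S}{(g_1,\dots,g_{d-2})}\Big)(-2,\,-\nu_d-\nu_{d-1})\;\Big|\;g_{d-1}\cdot w=0\ \text{ and }\ g_d\cdot w=0\,\Big\}.$$ -/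

import Mathlib

namespace ReesSym

noncomputable section

/-! ### Čech cohomology of a module with respect to a finite family of ring elements -/

section Cech

variable {ι : Type*} [LinearOrder ι] {A : Type*} [CommRing A] (x : ι → A)
  (M : Type*) [AddCommGroup M] [Module A M]

/-- The multiplicative set generated by the `x j` with `j ∈ σ`. -/
abbrev cechSubmonoid {ι A : Type*} [CommRing A] (x : ι → A) (σ : Finset ι) : Submonoid A := Submonoid.closure (x '' (σ : Set ι))

theorem cechSubmonoid_mono {ι A : Type*} [CommRing A] (x : ι → A) {σ τ : Finset ι} (h : σ ⊆ τ) :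
    cechSubmonoid x σ ≤ cechSubmonoid x τ :=
  Submonoid.closure_mono (Set.image_mono (Finset.coe_subset.mpr h))

/-- `Cⁱ = ∏ M_{x_σ}`, the product over the subsets `σ` with `i` elements. -/
abbrev CechCochain (i : ℕ) : Type _ :=
  (σ : {σ : Finset ι // σ.card = i}) → LocalizedModule (cechSubmonoid x σ.1) M

/-- The component `Cⁱ → M_{x_τ}` of the differential that omits `j ∈ τ`. -/
def cechFace (i : ℕ) (τ : {τ : Finset ι // τ.card = i + 1}) (j : {j : ι // j ∈ τ.1}) :
    CechCochain x M i →ₗ[A] LocalizedModule (cechSubmonoid x τ.1) M :=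
  LocalizedModule.liftOfLE (M := M) (cechSubmonoid x (τ.1.erase j.1)) (cechSubmonoid x τ.1)
      (cechSubmonoid_mono x (τ.1.erase_subset j.1)) ∘ₗ
    LinearMap.proj (R := A)
      (φ := fun σ : {σ : Finset ι // σ.card = i} => LocalizedModule (cechSubmonoid x σ.1) M)
      ⟨τ.1.erase j.1, by rw [Finset.card_erase_of_mem j.2, τ.2, Nat.add_sub_cancel]⟩

/-- The Čech differential `(δ c)_τ = ∑_{j ∈ τ} (-1)^{#{l ∈ τ : l < j}} c_{τ ∖ j}`. -/
def cechD (i : ℕ) : CechCochain x M i →ₗ[A] CechCochain x M (i + 1) :=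
  LinearMap.pi fun τ => ∑ j : {j : ι // j ∈ τ.1},
    (-1 : A) ^ (τ.1.filter (· < j.1)).card • cechFace x M i τ j

/-- The coboundaries in degree `i`. -/
def cechB : (i : ℕ) → Submodule A (CechCochain x M i)
  | 0 => ⊥
  | i + 1 => LinearMap.range (cechD x M i)

/-- The cocycles in degree `i`. -/
abbrev cechZ (i : ℕ) : Submodule A (CechCochain x M i) := LinearMap.ker (cechD x M i)

/-- The `i`-th Čech cohomology module, that is, for Noetherian `A`, the local cohomology module
`Hⁱ_{(x)}(M)`. -/
def CechH (i : ℕ) : Type _ := cechZ x M i ⧸ (cechB x M i).submoduleOf (cechZ x M i)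

instance (i : ℕ) : AddCommGroup (CechH x M i) :=
  inferInstanceAs (AddCommGroup (cechZ x M i ⧸ (cechB x M i).submoduleOf (cechZ x M i)))

instance (i : ℕ) : Module A (CechH x M i) :=
  inferInstanceAs (Module A (cechZ x M i ⧸ (cechB x M i).submoduleOf (cechZ x M i)))

/-- The class of a cocycle. -/
def cechClass (i : ℕ) : cechZ x M i →ₗ[A] CechH x M i :=
  ((cechB x M i).submoduleOf (cechZ x M i)).mkQ

end Cech

/-! ### The bigraded polynomial ring -/

section Ring

variable (k : Type*) [Field k] (d : ℕ)

/-- `R = k[x_1, …, x_d]`. -/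
abbrev PolyR : Type _ := MvPolynomial (Fin d) k

/-- `S = R[T_1, …, T_{d+1}]`. -/
abbrev PolyS : Type _ := MvPolynomial (Fin (d + 1)) (PolyR k d)

/-- The ideal `(x_1, …, x_d)` of `R`. -/
def maxIdealR : Ideal (PolyR k d) :=
  Ideal.span (Set.range (MvPolynomial.X : Fin d → PolyR k d))

/-- The variables `x_j` as elements of `S`. -/
def xS (j : Fin d) : PolyS k d := MvPolynomial.C (MvPolynomial.X j)

/-- The bihomogeneous component `S_{p,q}`, where `bideg T_i = (1,0)` and `bideg x_j = (0,1)`. -/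
def gradeS (p q : ℤ) : AddSubgroup (PolyS k d) where
  carrier := {s | ∀ (e : Fin (d + 1) →₀ ℕ) (u : Fin d →₀ ℕ),
    MvPolynomial.coeff u (MvPolynomial.coeff e s) ≠ 0 → (e.degree : ℤ) = p ∧ (u.degree : ℤ) = q}
  zero_mem' := fun e u h => absurd (by simp) h
  add_mem' := by
    intro a b ha hb e u h
    by_cases h0 : MvPolynomial.coeff u (MvPolynomial.coeff e a) = 0
    · refine hb e u fun h1 => h ?_
      rw [MvPolynomial.coeff_add, MvPolynomial.coeff_add, h0, h1, add_zero]
    · exact ha e u h0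
  neg_mem' := by
    intro a ha e u h
    refine ha e u fun h0 => h ?_
    rw [MvPolynomial.coeff_neg, MvPolynomial.coeff_neg, h0, neg_zero]

end Ring

/-! ### Bigraded `S`-modules -/

section Bigraded

variable {k : Type*} [Field k] {d : ℕ}

/-- `M(a, b)_{p,q} = M_{p+a, q+b}`. -/
def shift {M : Type*} [AddCommGroup M] (𝓜 : ℤ → ℤ → AddSubgroup M) (a b : ℤ) :
    ℤ → ℤ → AddSubgroup M :=
  fun p q => 𝓜 (p + a) (q + b)

/-- The bigrading induced on a submodule. -/
def gradeSub {M : Type*} [AddCommGroup M] [Module (PolyS k d) M] (𝓜 : ℤ → ℤ → AddSubgroup M)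
    (N : Submodule (PolyS k d) M) : ℤ → ℤ → AddSubgroup N :=
  fun p q => (𝓜 p q).comap N.subtype.toAddMonoidHom

/-- The submodule `{w ∈ M | a w = 0 and b w = 0}`. -/
def annihilatedBy (M : Type*) [AddCommGroup M] [Module (PolyS k d) M] (a b : PolyS k d) :
    Submodule (PolyS k d) M :=
  Submodule.torsionBy (PolyS k d) M a ⊓ Submodule.torsionBy (PolyS k d) M b

/-- The bigrading of `S/J` induced by that of `S` (for a bihomogeneous ideal `J`). -/
def gradeQuot (J : Ideal (PolyS k d)) : ℤ → ℤ → AddSubgroup (PolyS k d ⧸ J) :=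
  fun p q => (gradeS k d p q).map (Ideal.Quotient.mk J).toAddMonoidHom

/-- `M` and `N` are isomorphic as bigraded `S`-modules. -/
def BigradedIso (k : Type*) [Field k] (d : ℕ) {M N : Type*} [AddCommGroup M] [Module (PolyS k d) M]
    [AddCommGroup N] [Module (PolyS k d) N]
    (𝓜 : ℤ → ℤ → AddSubgroup M) (𝓝 : ℤ → ℤ → AddSubgroup N) : Prop :=
  ∃ e : M ≃ₗ[PolyS k d] N, ∀ (p q : ℤ) (m : M), m ∈ 𝓜 p q ↔ e m ∈ 𝓝 p q

variable (M : Type*) [AddCommGroup M] [Module (PolyS k d) M]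

/-- The bigrading of the localization `M_{x_σ}`: it is generated by the fractions `m / s` with
`m` and `s` bihomogeneous, and `bideg (m / s) = bideg m - bideg s`. -/
def gradeLoc (𝓜 : ℤ → ℤ → AddSubgroup M) (σ : Finset (Fin d)) (p q : ℤ) :
    AddSubgroup (LocalizedModule (cechSubmonoid (xS k d) σ) M) :=
  AddSubgroup.closure {z | ∃ (a b : ℤ) (s : cechSubmonoid (xS k d) σ) (m : M),
    (s : PolyS k d) ∈ gradeS k d a b ∧ m ∈ 𝓜 (p + a) (q + b) ∧ z = LocalizedModule.mk m s}

/-- The local cohomology module `Hⁱ_𝔪(M)`, as the cohomology of the Čech complex of `M` on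
`x_1, …, x_d`. -/
abbrev LocalCoh (k : Type*) [Field k] (d : ℕ) (M : Type*) [AddCommGroup M]
    [Module (PolyS k d) M] (i : ℕ) : Type _ := CechH (xS k d) M i

/-- The bigrading of `Hⁱ_𝔪(M)`: the component of bidegree `(p, q)` consists of the classes of
the cocycles all of whose entries have bidegree `(p, q)`. -/
def gradeLocalCoh (𝓜 : ℤ → ℤ → AddSubgroup M) (i : ℕ) (p q : ℤ) :
    AddSubgroup (LocalCoh k d M i) :=
  ((AddSubgroup.pi Set.univ fun σ : {σ : Finset (Fin d) // σ.card = i} =>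
      gradeLoc M 𝓜 σ.1 p q).comap (cechZ (xS k d) M i).subtype.toAddMonoidHom).map
    (cechClass (xS k d) M i).toAddMonoidHom

end Bigraded

/-! ### The kernel of `Sym(I) → 𝓡(I)` -/

section Kernel

/-- The canonical map `Sym(I) → 𝓡(I)`, given on `I` by `a ↦ a t`. -/
def symToRees {R : Type*} [CommRing R] (I : Ideal R) :
    SymmetricAlgebra R I →ₐ[R] reesAlgebra I :=
  SymmetricAlgebra.lift
    (((Polynomial.monomial 1).comp I.subtype).codRestrict (reesAlgebra I).toSubmodule
      fun a => reesAlgebra.monomial_mem.mpr (by simp))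

variable {k : Type*} [Field k] {d : ℕ} (f : Fin (d + 1) → PolyR k d)

/-- The ideal `I = (f_1, …, f_{d+1})`. -/
abbrev idealI : Ideal (PolyR k d) := Ideal.span (Set.range f)

/-- The map `β : S → Sym(I)`, `T_i ↦ f_i`. -/
def betaMap : PolyS k d →ₐ[PolyR k d] SymmetricAlgebra (PolyR k d) (idealI f) :=
  MvPolynomial.aeval fun i =>
    SymmetricAlgebra.ι (PolyR k d) (idealI f) ⟨f i, Ideal.subset_span (Set.mem_range_self i)⟩

/-- `𝓚 = ker (Sym(I) → 𝓡(I))`. -/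
def KerK : Type _ := RingHom.ker (symToRees (idealI f))

instance : AddCommGroup (KerK f) :=
  inferInstanceAs (AddCommGroup (RingHom.ker (symToRees (idealI f))))

/-- `S` acts on `𝓚` through `β`. -/
instance : Module (PolyS k d) (KerK f) :=
  Module.compHom (RingHom.ker (symToRees (idealI f))) (betaMap f).toRingHom

/-- The inclusion of `𝓚` into `Sym(I)`. -/
def KerK.incl : KerK f →+ SymmetricAlgebra (PolyR k d) (idealI f) :=
  (RingHom.ker (symToRees (idealI f))).subtype.toAddMonoidHom

/-- The bigrading of `𝓚` as a submodule of `Sym(I)`, where `Sym(I)_{p,q} = β(S_{p,q})`. -/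
def gradeK (p q : ℤ) : AddSubgroup (KerK f) :=
  ((gradeS k d p q).map (betaMap f).toRingHom.toAddMonoidHom).comap (KerK.incl f)

end Kernel

/-! ### Hypotheses on the ideal -/

section Hypotheses

/-- The grade of an ideal: the supremum of the lengths of the regular sequences in it. -/
def grade {R : Type*} [CommRing R] (I : Ideal R) : ℕ∞ :=
  ⨆ (rs : List R) (_ : RingTheory.Sequence.IsRegular R rs ∧ ∀ r ∈ rs, r ∈ I), (rs.length : ℕ∞)

/-- `I` is perfect: the projective dimension of `R/I` equals the grade of `I`. -/
def IsPerfectIdeal {R : Type*} [CommRing R] (I : Ideal R) : Prop :=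
  CategoryTheory.projectiveDimension (ModuleCat.of R (R ⧸ I)) = (grade I : WithBot ℕ∞)

/-- The condition `G_d`: `μ(I_𝔭) ≤ dim R_𝔭` for every prime `𝔭 ∈ V(I)` other than
`(x_1, …, x_d)`. -/
def SatisfiesG {k : Type*} [Field k] {d : ℕ} (I : Ideal (PolyR k d)) : Prop :=
  ∀ (P : Ideal (PolyR k d)) [P.IsPrime], I ≤ P → P ≠ maxIdealR k d →
    ((Submodule.spanFinrank (I.map (algebraMap (PolyR k d) (Localization.AtPrime P))) : ℕ) :
      WithBot ℕ∞) ≤ ringKrullDim (Localization.AtPrime P)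

variable {k : Type*} [Field k] {d : ℕ}

/-- `φ` is a homogeneous Hilbert–Burch matrix of `I = (f_1, …, f_{d+1})`: the entries of its
`j`-th column are homogeneous of degree `ν_j` and `0 → R^d → R^{d+1} → I → 0` is exact. -/
structure IsHilbertBurch (f : Fin (d + 1) → PolyR k d)
    (φ : Matrix (Fin (d + 1)) (Fin d) (PolyR k d)) (νs : Fin d → ℕ) : Prop where
  homogeneous : ∀ i j, (φ i j).IsHomogeneous (νs j)
  injective : Function.Injective φ.mulVecLin
  exact : Function.Exact φ.mulVecLin (Fintype.linearCombination (PolyR k d) f)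

/-- `[g_1, …, g_d] = [T_1, …, T_{d+1}] · φ`. -/
def gOf (φ : Matrix (Fin (d + 1)) (Fin d) (PolyR k d)) (j : Fin d) : PolyS k d :=
  ∑ i, MvPolynomial.C (φ i j) * MvPolynomial.X i

/-- The ideal `(g_1, …, g_r)` of `S`. -/
def gIdeal (φ : Matrix (Fin (d + 1)) (Fin d) (PolyR k d)) (r : ℕ) : Ideal (PolyS k d) :=
  Ideal.span (gOf φ '' {j | (j : ℕ) < r})

end Hypotheses

end

end ReesSym

/-! Write `A_r = S/(g_1, …, g_r)`. Exactness of the presentation gives `Sym(I) = A_d`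
(`betaMap_eq_zero_iff`). The theorem follows from three facts: `𝓚 = H⁰_𝔪(A_d)`; the `g_j` form a
regular sequence; and `Hⁱ_𝔪(A_r) = 0` for `i + r < d`. Given these, the long exact sequence of
multiplication by `g_d` on `A_{d-1}` identifies `H⁰_𝔪(A_d)` with the part of `H¹_𝔪(A_{d-1})` killed
by `g_d`. In the same way `H¹_𝔪(A_{d-1})` is the part of `H²_𝔪(A_{d-2})` killed by `g_{d-1}`. Each
connecting map lowers the bidegree by that of the `g` involved, which produces the shift.

The first two facts come from `G_d` by counting heights. Let `Q` be a prime of `S` over `p ⊂ R`. If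
`Q` contains linear forms whose coefficient vectors have rank `t` modulo `p`, then `ht Q ≥ ht p + t`
(`height_add_finrank_le`). Presenting `I` at `p` gives `d + 1 ≤ μ(I_p) + rank φ(p)`. Hence `G_d`
yields `d + 1 ≤ ht p + rank φ(p)` whenever `I ≤ p ≠ 𝔪`. If `I` is not contained in `p`, the rank is
at least `d`, and `𝔪` itself has height at least `d`. So a prime containing `g_1, …, g_r` has height
at least `r` (`le_height_of_gOf_mem`). Associated primes of `A_r` have height at most `r`
(`height_le_of_mem_associatedPrimes`), and regularity follows by induction (`isSMulRegular_gOf`).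
The same count shows that an associated prime of `A_d` containing `I` lies over `𝔪`. Off `V(I)` the
Koszul relations already make `Sym(I)` and the Rees algebra agree, so `𝓚` is `𝔪`-torsion
(`exists_pow_mul_mem_gIdeal`). Conversely, all torsion lies in `𝓚` because `R[t]` is a domain.

Vanishing of Čech cohomology in low degrees serves as the notion of depth throughout. For the family
`x_1, …, x_d` it gives the third fact. For a regular sequence of length `2d + 1` in a maximal ideal
of `S` it gives the unmixedness of `A_r`. -/

namespace ReesSym

noncomputable section

set_option linter.unusedSectionVars false

/-! ### Čech complexes: differential, exactness, torsion, vanishing. -/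

section CechGeneral

variable {ι : Type*} [LinearOrder ι] {A : Type*} [CommRing A] (x : ι → A)
  {M : Type*} [AddCommGroup M] [Module A M] {N : Type*} [AddCommGroup N] [Module A N]

/-- The restriction `M_{x_σ} → M_{x_τ}` for `σ ⊆ τ`. -/
def cechRes (M : Type*) [AddCommGroup M] [Module A M] {σ τ : Finset ι} (h : σ ⊆ τ) :
    LocalizedModule (cechSubmonoid x σ) M →ₗ[A] LocalizedModule (cechSubmonoid x τ) M :=
  LocalizedModule.liftOfLE (M := M) _ _ (cechSubmonoid_mono x h)

theorem cechRes_mk {σ τ : Finset ι} (h : σ ⊆ τ) (m : M) (s : cechSubmonoid x σ) :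
    cechRes x M h (LocalizedModule.mk m s) =
      LocalizedModule.mk m ⟨s.1, cechSubmonoid_mono x h s.2⟩ := by
  rw [IsLocalizedModule.mk_eq_mk', IsLocalizedModule.mk_eq_mk']
  exact IsLocalizedModule.liftOfLE_mk' _ _ _ _ _ _ _

theorem cechRes_cechRes {σ τ ρ : Finset ι} (h : σ ⊆ τ) (h' : τ ⊆ ρ)
    (z : LocalizedModule (cechSubmonoid x σ) M) :
    cechRes x M h' (cechRes x M h z) = cechRes x M (h.trans h') z := by
  induction z using LocalizedModule.induction_on with
  | h m s => rw [cechRes_mk, cechRes_mk, cechRes_mk]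

/-- The entry `c_σ` of a cochain, restricted to `M_{x_ρ}`; zero unless `σ` has `i` elements and
is contained in `ρ`. -/
def cechPush {i : ℕ} (c : CechCochain x M i) (ρ σ : Finset ι) :
    LocalizedModule (cechSubmonoid x ρ) M :=
  if h : σ.card = i ∧ σ ⊆ ρ then cechRes x M h.2 (c ⟨σ, h.1⟩) else 0

/-- The sign `(-1)^{#{l ∈ τ : l < j}}`. -/
def cechSign (A : Type*) [CommRing A] (τ : Finset ι) (j : ι) : A :=
  (-1 : A) ^ (τ.filter (· < j)).card

theorem cechSign_mul_self (τ : Finset ι) (j : ι) :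
    cechSign A τ j * cechSign A τ j = 1 := by
  rw [cechSign, ← pow_add, ← two_mul, pow_mul]; simp

theorem cechSign_erase_of_lt {τ : Finset ι} {j l : ι} (hj : j ∈ τ) (h : j < l) :
    cechSign A (τ.erase j) l = - cechSign A τ l := by
  have h1 : (τ.erase j).filter (· < l) = (τ.filter (· < l)).erase j := by
    ext a; simp only [Finset.mem_filter, Finset.mem_erase]; tauto
  have h2 : j ∈ τ.filter (· < l) := by simp [hj, h]
  have h3 := Finset.card_erase_add_one h2
  rw [cechSign, cechSign, h1, ← h3, pow_succ]; ring

theorem cechSign_erase_of_gt {τ : Finset ι} {j l : ι} (h : l < j) :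
    cechSign A (τ.erase j) l = cechSign A τ l := by
  have h1 : (τ.erase j).filter (· < l) = τ.filter (· < l) := by
    ext a; simp only [Finset.mem_filter, Finset.mem_erase]
    constructor
    · tauto
    · rintro ⟨h1, h2⟩; exact ⟨⟨(h2.trans h).ne, h1⟩, h2⟩
  rw [cechSign, cechSign, h1]

/-- Deleting the smaller of two indices flips the sign of the larger one, while deleting the larger
leaves the sign of the smaller unchanged. -/
theorem cechSign_swap {τ : Finset ι} {j l : ι} (hj : j ∈ τ) (hl : l ∈ τ) (h : j ≠ l) :
    cechSign A τ j * cechSign A (τ.erase j) l =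
      - (cechSign A τ l * cechSign A (τ.erase l) j) := by
  rcases lt_or_gt_of_ne h with h | h
  · rw [cechSign_erase_of_lt hj h, cechSign_erase_of_gt h]; ring
  · rw [cechSign_erase_of_lt hl h, cechSign_erase_of_gt h]; ring

theorem cechRes_cechPush {i : ℕ} (c : CechCochain x M i) {ρ ρ' σ : Finset ι} (hσ : σ ⊆ ρ)
    (h : ρ ⊆ ρ') :
    cechRes x M h (cechPush x c ρ σ) = cechPush x c ρ' σ := by
  by_cases hc : σ.card = i
  · rw [cechPush, cechPush, dif_pos ⟨hc, hσ⟩, dif_pos ⟨hc, hσ.trans h⟩, cechRes_cechRes]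
  · rw [cechPush, cechPush, dif_neg (by tauto), dif_neg (by tauto), map_zero]

theorem cechD_apply {i : ℕ} (c : CechCochain x M i) (τ : {τ : Finset ι // τ.card = i + 1}) :
    cechD x M i c τ = ∑ j ∈ τ.1, cechSign A τ.1 j • cechPush x c τ.1 (τ.1.erase j) := by
  rw [← Finset.sum_coe_sort, cechD, LinearMap.pi_apply, LinearMap.sum_apply]
  refine Finset.sum_congr rfl fun j _ => ?_
  rw [LinearMap.smul_apply, cechPush, dif_pos ⟨by
    rw [Finset.card_erase_of_mem j.2, τ.2, Nat.add_sub_cancel], τ.1.erase_subset _⟩]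
  rfl

theorem cechPush_cechD {i : ℕ} (c : CechCochain x M i) {ρ τ : Finset ι} (hτ : τ.card = i + 1)
    (h : τ ⊆ ρ) :
    cechPush x (cechD x M i c) ρ τ =
      ∑ j ∈ τ, cechSign A τ j • cechPush x c ρ (τ.erase j) := by
  rw [cechPush, dif_pos ⟨hτ, h⟩, cechD_apply, map_sum]
  refine Finset.sum_congr rfl fun j _ => ?_
  rw [map_smul, cechRes_cechPush x c (τ.erase_subset _) h]

theorem cechD_cechD {i : ℕ} (c : CechCochain x M i) : cechD x M (i + 1) (cechD x M i c) = 0 := by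
  funext ρ
  rw [cechD_apply]
  have : ∀ j ∈ ρ.1, cechSign A ρ.1 j • cechPush x (cechD x M i c) ρ.1 (ρ.1.erase j) =
      ∑ l ∈ ρ.1.erase j, (cechSign A ρ.1 j * cechSign A (ρ.1.erase j) l) •
        cechPush x c ρ.1 ((ρ.1.erase j).erase l) := by
    intro j hj
    rw [cechPush_cechD x c (by rw [Finset.card_erase_of_mem hj, ρ.2]; rfl) (ρ.1.erase_subset _),
      Finset.smul_sum]
    simp_rw [smul_smul]
  rw [Finset.sum_congr rfl this, Finset.sum_sigma']
  -- Removing `j` then `l` cancels against removing `l` then `j`.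
  refine Finset.sum_involution (fun a _ => ⟨a.2, a.1⟩) ?_ ?_ ?_ ?_
  · rintro ⟨j, l⟩ ha
    simp only [Finset.mem_sigma, Finset.mem_erase] at ha
    rw [cechSign_swap ha.1 ha.2.2 (Ne.symm ha.2.1), Finset.erase_right_comm, neg_smul]
    exact neg_add_cancel _
  · rintro ⟨j, l⟩ ha _ h
    simp only [Finset.mem_sigma, Finset.mem_erase] at ha
    simp only [Sigma.mk.injEq, heq_eq_eq] at h
    exact ha.2.1 h.1
  · rintro ⟨j, l⟩ ha
    simp only [Finset.mem_sigma, Finset.mem_erase] at ha ⊢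
    exact ⟨ha.2.2, Ne.symm ha.2.1, ha.1⟩
  · rintro ⟨j, l⟩ _; rfl

/-! #### Functoriality and exactness -/

/-- The map of Čech cochains induced by a linear map. -/
def cechMap (i : ℕ) (π : M →ₗ[A] N) : CechCochain x M i →ₗ[A] CechCochain x N i :=
  LinearMap.pi fun σ => IsLocalizedModule.map (cechSubmonoid x σ.1)
    (LocalizedModule.mkLinearMap (cechSubmonoid x σ.1) M)
    (LocalizedModule.mkLinearMap (cechSubmonoid x σ.1) N) π ∘ₗ
      LinearMap.proj (R := A)
        (φ := fun σ : {σ : Finset ι // σ.card = i} => LocalizedModule (cechSubmonoid x σ.1) M) σ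

theorem cechMap_apply_of_eq_mk {i : ℕ} (π : M →ₗ[A] N) (c : CechCochain x M i)
    (σ : {σ : Finset ι // σ.card = i}) {m : M} {s : cechSubmonoid x σ.1}
    (h : c σ = LocalizedModule.mk m s) :
    cechMap x i π c σ = LocalizedModule.mk (π m) s := by
  rw [← IsLocalizedModule.map_LocalizedModules, ← h]; rfl

theorem cechRes_map {σ τ : Finset ι} (h : σ ⊆ τ) (π : M →ₗ[A] N)
    (z : LocalizedModule (cechSubmonoid x σ) M) :
    cechRes x N h (IsLocalizedModule.map (cechSubmonoid x σ)
      (LocalizedModule.mkLinearMap (cechSubmonoid x σ) M)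
      (LocalizedModule.mkLinearMap (cechSubmonoid x σ) N) π z) =
    IsLocalizedModule.map (cechSubmonoid x τ)
      (LocalizedModule.mkLinearMap (cechSubmonoid x τ) M)
      (LocalizedModule.mkLinearMap (cechSubmonoid x τ) N) π (cechRes x M h z) := by
  induction z using LocalizedModule.induction_on with
  | h m s =>
    rw [cechRes_mk, IsLocalizedModule.map_LocalizedModules, IsLocalizedModule.map_LocalizedModules,
      cechRes_mk]

theorem cechPush_cechMap {i : ℕ} (π : M →ₗ[A] N) (c : CechCochain x M i) (ρ σ : Finset ι) :
    cechPush x (cechMap x i π c) ρ σ = IsLocalizedModule.map (cechSubmonoid x ρ)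
      (LocalizedModule.mkLinearMap (cechSubmonoid x ρ) M)
      (LocalizedModule.mkLinearMap (cechSubmonoid x ρ) N) π (cechPush x c ρ σ) := by
  by_cases h : σ.card = i ∧ σ ⊆ ρ
  · rw [cechPush, cechPush, dif_pos h, dif_pos h, ← cechRes_map]; rfl
  · rw [cechPush, cechPush, dif_neg h, dif_neg h, map_zero]

theorem cechD_cechMap {i : ℕ} (π : M →ₗ[A] N) (c : CechCochain x M i) :
    cechD x N i (cechMap x i π c) = cechMap x (i + 1) π (cechD x M i c) := by
  funext τ
  rw [cechD_apply]
  simp_rw [cechPush_cechMap]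
  change _ = IsLocalizedModule.map (cechSubmonoid x τ.1)
    (LocalizedModule.mkLinearMap (cechSubmonoid x τ.1) M)
    (LocalizedModule.mkLinearMap (cechSubmonoid x τ.1) N) π (cechD x M i c τ)
  rw [cechD_apply, map_sum]
  simp_rw [map_smul]

theorem cechMap_surjective (i : ℕ) {π : M →ₗ[A] N} (hπ : Function.Surjective π) :
    Function.Surjective (cechMap x i π) := by
  intro c
  choose b hb using fun σ : {σ : Finset ι // σ.card = i} =>
    IsLocalizedModule.map_surjective (cechSubmonoid x σ.1)
      (LocalizedModule.mkLinearMap (cechSubmonoid x σ.1) M)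
      (LocalizedModule.mkLinearMap (cechSubmonoid x σ.1) N) π hπ (c σ)
  exact ⟨b, funext hb⟩

/-- If the kernel of `π` is `g M`, a cochain killed by `π` is a multiple of `g`. -/
theorem exists_smul_of_cechMap_eq_zero {i : ℕ} {π : M →ₗ[A] N} {g : A}
    (hπ : ∀ m, π m = 0 → ∃ m', g • m' = m) {c : CechCochain x M i} (hc : cechMap x i π c = 0) :
    ∃ b : CechCochain x M i, g • b = c := by
  have : ∀ σ : {σ : Finset ι // σ.card = i}, ∃ b : LocalizedModule (cechSubmonoid x σ.1) M,
      g • b = c σ := by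
    intro σ
    obtain ⟨⟨m, s⟩, hms⟩ : ∃ p : M × cechSubmonoid x σ.1, LocalizedModule.mk p.1 p.2 = c σ := by
      induction h : c σ using LocalizedModule.induction_on with
      | h m s => exact ⟨(m, s), rfl⟩
    have h0 := cechMap_apply_of_eq_mk x π c σ hms.symm
    rw [hc, Pi.zero_apply, eq_comm, ← LocalizedModule.zero_mk 1, LocalizedModule.mk_eq] at h0
    obtain ⟨u, hu⟩ := h0
    simp only [one_smul, smul_zero] at hu
    -- Only `u • m` need lie in the kernel; the extra factor `u` is absorbed into the denominator.
    obtain ⟨m', hm'⟩ := hπ (u • m) (by rw [Submonoid.smul_def, map_smul]; exact hu)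
    refine ⟨LocalizedModule.mk m' (u * s), ?_⟩
    rw [← hms, LocalizedModule.smul'_mk, hm', LocalizedModule.mk_cancel_common_left]
  choose b hb using this
  exact ⟨b, funext hb⟩

/-- Regularity of `g` survives localization, hence holds in each factor of the cochain module. -/
theorem cechCochain_smul_injective (i : ℕ) {g : A} (hg : IsSMulRegular M g)
    {c c' : CechCochain x M i} (h : g • c = g • c') : c = c' := by
  rw [← sub_eq_zero, ← smul_sub] at h
  rw [← sub_eq_zero]
  generalize c - c' = b at h
  funext σ
  have h1 : g • b σ = 0 := congrFun h σ
  rw [Pi.zero_apply]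
  induction h : b σ using LocalizedModule.induction_on with
  | h m s =>
    rw [h, LocalizedModule.smul'_mk, ← LocalizedModule.zero_mk 1, LocalizedModule.mk_eq] at h1
    obtain ⟨u, hu⟩ := h1
    rw [one_smul, smul_zero, smul_zero, Submonoid.smul_def, smul_comm] at hu
    rw [← LocalizedModule.zero_mk 1, LocalizedModule.mk_eq]
    refine ⟨u, ?_⟩
    rw [one_smul, smul_zero, smul_zero, Submonoid.smul_def]
    exact hg (by simpa using hu)

/-! #### Cohomology classes are torsion -/

theorem exists_pow_mul_of_mem_cechSubmonoid_insert {σ : Finset ι} {j : ι} {s : A}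
    (hs : s ∈ cechSubmonoid x (insert j σ)) :
    ∃ (n : ℕ) (t : A), t ∈ cechSubmonoid x σ ∧ s = x j ^ n * t := by
  induction hs using Submonoid.closure_induction with
  | mem s hs =>
    obtain ⟨l, hl, rfl⟩ := hs
    rcases Finset.mem_insert.mp hl with rfl | hl
    · exact ⟨1, 1, one_mem _, by simp⟩
    · exact ⟨0, x l, Submonoid.subset_closure ⟨l, hl, rfl⟩, by simp⟩
  | one => exact ⟨0, 1, one_mem _, by simp⟩
  | mul a b _ _ ha hb =>
    obtain ⟨n, t, ht, rfl⟩ := ha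
    obtain ⟨m, u, hu, rfl⟩ := hb
    exact ⟨n + m, t * u, mul_mem ht hu, by ring⟩

theorem exists_pow_smul_eq_cechRes {σ : Finset ι} (j : ι)
    (z : LocalizedModule (cechSubmonoid x (insert j σ)) M) :
    ∃ (n : ℕ) (b : LocalizedModule (cechSubmonoid x σ) M),
      cechRes x M (Finset.subset_insert j σ) b = x j ^ n • z := by
  induction z using LocalizedModule.induction_on with
  | h m s =>
    obtain ⟨n, t, ht, hs⟩ := exists_pow_mul_of_mem_cechSubmonoid_insert x s.2
    refine ⟨n, LocalizedModule.mk m ⟨t, ht⟩, ?_⟩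
    rw [cechRes_mk, LocalizedModule.smul'_mk, LocalizedModule.mk_eq]
    refine ⟨1, ?_⟩
    rw [one_smul, one_smul, Submonoid.smul_def, Submonoid.smul_def, hs, smul_smul]
    exact congrArg (· • m) (mul_comm _ _)

theorem exists_pow_smul_eq_zero_of_cechRes {σ : Finset ι} (j : ι)
    {z : LocalizedModule (cechSubmonoid x σ) M}
    (hz : cechRes x M (Finset.subset_insert j σ) z = 0) : ∃ n : ℕ, x j ^ n • z = 0 := by
  induction z using LocalizedModule.induction_on with
  | h m s =>
    rw [cechRes_mk, ← LocalizedModule.zero_mk 1, LocalizedModule.mk_eq] at hz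
    obtain ⟨u, hu⟩ := hz
    obtain ⟨n, t, ht, hs⟩ := exists_pow_mul_of_mem_cechSubmonoid_insert x u.2
    refine ⟨n, ?_⟩
    rw [LocalizedModule.smul'_mk, ← LocalizedModule.zero_mk 1, LocalizedModule.mk_eq]
    refine ⟨⟨t, ht⟩, ?_⟩
    rw [one_smul, smul_zero, smul_zero, Submonoid.smul_def] at hu ⊢
    rw [hs, mul_comm, mul_smul] at hu
    exact hu

theorem exists_pow_smul_eq_zero_of_cechD_zero (j : ι) {c : CechCochain x M 0}
    (hc : cechD x M 0 c = 0) : ∃ n : ℕ, x j ^ n • c = 0 := by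
  have h1 : cechRes x M (Finset.subset_insert j ∅) (c ⟨∅, rfl⟩) = 0 := by
    have h2 := congrFun hc ⟨{j}, rfl⟩
    rw [cechD_apply, Finset.sum_singleton, Finset.erase_singleton, cechSign,
      Finset.filter_singleton, if_neg (lt_irrefl j), Finset.card_empty, pow_zero, one_smul,
      cechPush, dif_pos ⟨rfl, Finset.empty_subset _⟩] at h2
    exact h2
  obtain ⟨n, hn⟩ := exists_pow_smul_eq_zero_of_cechRes x j h1
  refine ⟨n, funext fun σ => ?_⟩
  obtain ⟨σ, hσ⟩ := σ
  obtain rfl := Finset.card_eq_zero.mp hσ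
  exact hn

/-- After inverting `x j` the Čech complex is contracted by the homotopy `c ↦ (σ ↦ ± c_{σ ∪ j})`.
Multiplying by a power of `x j` brings its values back to `M_{x_σ}`, and a further power removes the
error, which dies in `M_{x_{τ ∪ j}}`. -/
theorem exists_pow_smul_mem_range_cechD [Finite ι] (j : ι) {i : ℕ} {c : CechCochain x M (i + 1)}
    (hc : cechD x M (i + 1) c = 0) :
    ∃ (n : ℕ) (b : CechCochain x M i), cechD x M i b = x j ^ n • c := by
  have := Fintype.ofFinite ι
  have h1 : ∃ n : ℕ, ∀ σ : {σ : Finset ι // σ.card = i},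
      ∃ b : LocalizedModule (cechSubmonoid x σ.1) M, cechRes x M (Finset.subset_insert j σ.1) b =
        x j ^ n • cechPush x c (insert j σ.1) (insert j σ.1) := by
    choose n b hb using fun σ : {σ : Finset ι // σ.card = i} =>
      exists_pow_smul_eq_cechRes x j (cechPush x c (insert j σ.1) (insert j σ.1))
    -- The sum of the exponents is one that works for all the finitely many `σ` at once.
    refine ⟨∑ σ, n σ, fun σ => ⟨x j ^ (∑ σ, n σ - n σ) • b σ, ?_⟩⟩
    rw [map_smul, hb, smul_smul, ← pow_add,
      Nat.sub_add_cancel (Finset.single_le_sum (fun _ _ => Nat.zero_le _) (Finset.mem_univ σ))]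
  obtain ⟨n, hn⟩ := h1
  choose b₀ hb₀ using hn
  let b : CechCochain x M i := fun σ =>
    if j ∈ σ.1 then 0 else cechSign A (insert j σ.1) j • b₀ σ
  have hbj : ∀ ρ σ : Finset ι, j ∈ σ → cechPush x b ρ σ = 0 := by
    intro ρ σ hσ
    by_cases h : σ.card = i ∧ σ ⊆ ρ
    · rw [cechPush, dif_pos h]; simp only [b]; rw [if_pos hσ, map_zero]
    · rw [cechPush, dif_neg h]
  have hb : ∀ ρ σ : Finset ι, σ.card = i → j ∉ σ → insert j σ ⊆ ρ →
      cechPush x b ρ σ = (x j ^ n * cechSign A (insert j σ) j) • cechPush x c ρ (insert j σ) := by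
    intro ρ σ hσ hj hρ
    have h2 := hb₀ ⟨σ, hσ⟩
    rw [cechPush, dif_pos ⟨hσ, (Finset.subset_insert j σ).trans hρ⟩]
    simp only [b]
    rw [if_neg hj, map_smul, ← cechRes_cechRes x (Finset.subset_insert j σ) hρ, h2, map_smul,
      cechRes_cechPush x c subset_rfl hρ, smul_smul, mul_comm]
  have key : ∀ τ : {τ : Finset ι // τ.card = i + 1},
      cechRes x M (Finset.subset_insert j τ.1) (cechD x M i b τ - x j ^ n • c τ) = 0 := by
    rintro ⟨τ, hτ⟩
    rw [map_sub, map_smul, sub_eq_zero]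
    have e1 : cechRes x M (Finset.subset_insert j τ) (c ⟨τ, hτ⟩) =
        cechPush x c (insert j τ) τ := by
      rw [cechPush, dif_pos ⟨hτ, Finset.subset_insert j τ⟩]
    have e2 : cechRes x M (Finset.subset_insert j τ) (cechD x M i b ⟨τ, hτ⟩) =
        cechPush x (cechD x M i b) (insert j τ) τ := by
      rw [cechPush, dif_pos ⟨hτ, Finset.subset_insert j τ⟩]
    rw [e1, e2, cechPush_cechD x b hτ (Finset.subset_insert j τ)]
    by_cases hj : j ∈ τ
    · rw [Finset.sum_eq_single_of_mem j hj fun l _ hlj => by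
        rw [hbj _ _ (Finset.mem_erase.mpr ⟨hlj.symm, hj⟩), smul_zero]]
      rw [hb _ _ (by rw [Finset.card_erase_of_mem hj, hτ]; rfl) (Finset.notMem_erase j τ)
        (by rw [Finset.insert_erase hj]; exact Finset.subset_insert _ _), Finset.insert_erase hj,
        smul_smul, mul_left_comm, cechSign_mul_self, mul_one]
    · have hcard : (insert j τ).card = i + 1 + 1 := by rw [Finset.card_insert_of_notMem hj, hτ]
      have h3 := cechPush_cechD x c hcard subset_rfl
      rw [hc, Finset.sum_insert hj, Finset.erase_insert hj] at h3
      have h4 : cechPush x (0 : CechCochain x M (i + 1 + 1)) (insert j τ) (insert j τ) = 0 := by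
        rw [cechPush, dif_pos ⟨hcard, subset_rfl⟩]; exact map_zero _
      rw [h4] at h3
      -- For `j ∉ τ`, the cocycle condition on `τ ∪ j` expresses `c_τ` through the entries `c_{τ ∪ j
      -- ∖ l}`. These are exactly the entries from which `b` is built.
      have h5 : ∀ l ∈ τ, cechSign A τ l • cechPush x b (insert j τ) (τ.erase l) =
          -((x j ^ n * cechSign A (insert j τ) j) •
            (cechSign A (insert j τ) l • cechPush x c (insert j τ) ((insert j τ).erase l))) := by
        intro l hl
        have hjl : j ≠ l := fun h => hj (h ▸ hl)
        have h6 : (insert j τ).erase l = insert j (τ.erase l) :=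
          Finset.erase_insert_of_ne hjl
        have h7 := cechSign_swap (A := A) (Finset.mem_insert_self j τ)
          (Finset.mem_insert_of_mem hl) hjl
        rw [Finset.erase_insert hj] at h7
        have h8 : cechSign A τ l * cechSign A ((insert j τ).erase l) j =
            - (cechSign A (insert j τ) j * cechSign A (insert j τ) l) := by
          have e3 := cechSign_mul_self (A := A) (insert j τ) j
          have e4 := cechSign_mul_self (A := A) ((insert j τ).erase l) j
          linear_combination (-cechSign A τ l * cechSign A ((insert j τ).erase l) j) * e3 +
            cechSign A (insert j τ) j * cechSign A ((insert j τ).erase l) j * h7 -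
              cechSign A (insert j τ) j * cechSign A (insert j τ) l * e4
        rw [hb _ _ (by rw [Finset.card_erase_of_mem hl, hτ]; rfl)
          (fun h => hj (Finset.mem_of_mem_erase h)) (by
            rw [← h6]; exact Finset.erase_subset _ _), ← h6, smul_smul, smul_smul, ← neg_smul]
        congr 1
        linear_combination x j ^ n * h8
      rw [Finset.sum_congr rfl h5, Finset.sum_neg_distrib, ← Finset.smul_sum,
        ← neg_eq_of_add_eq_zero_right h3.symm, smul_neg, neg_neg, smul_smul, mul_assoc,
        cechSign_mul_self, mul_one]
  choose m hm using fun τ => exists_pow_smul_eq_zero_of_cechRes x j (key τ)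
  refine ⟨∑ τ, m τ + n, x j ^ (∑ τ, m τ) • b, ?_⟩
  rw [map_smul, pow_add, mul_smul, ← sub_eq_zero, ← smul_sub]
  funext τ
  rw [← Nat.sub_add_cancel (Finset.single_le_sum (f := m) (fun _ _ => Nat.zero_le _)
    (Finset.mem_univ τ)), pow_add, mul_smul]
  exact (congrArg (x j ^ (∑ τ, m τ - m τ) • ·) (hm τ)).trans (smul_zero _)

/-! #### Vanishing of Čech cohomology in low degrees -/

/-- The Čech cohomology of `M` vanishes in the degrees `< n`. -/
def CechVanish (M : Type*) [AddCommGroup M] [Module A M] (n : ℕ) : Prop :=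
  ∀ i < n, ∀ c : CechCochain x M i, cechD x M i c = 0 → c ∈ cechB x M i

/-- A regular element lowers the range of vanishing by at most one. -/
theorem CechVanish.quotient {n : ℕ} (h : CechVanish x M (n + 1)) {g : A} (hg : IsSMulRegular M g)
    {π : M →ₗ[A] N} (hπ : Function.Surjective π) (hker : ∀ m, π m = 0 ↔ ∃ m', g • m' = m) :
    CechVanish x N n := by
  intro i hi c hc
  obtain ⟨b, rfl⟩ := cechMap_surjective x i hπ c
  rw [cechD_cechMap] at hc
  obtain ⟨z, hz⟩ := exists_smul_of_cechMap_eq_zero x (fun m => (hker m).mp) hc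
  -- `g • δz = δδb = 0`, and `g` is regular on cochains.
  have hz0 : cechD x M (i + 1) z = 0 := by
    refine cechCochain_smul_injective x _ hg ?_
    rw [← map_smul, hz, cechD_cechD, smul_zero]
  -- Since `z = δw`, the lift `b` may be corrected to the cocycle `b - g • w` without changing its
  -- image under `π`.
  obtain ⟨w, hw⟩ := h (i + 1) (by omega) z hz0
  have hb : cechD x M i (b - g • w) = 0 := by rw [map_sub, map_smul, hw, hz, sub_self]
  have hgw : cechMap x i π (g • w) = 0 := by
    funext σ
    induction hs : (w σ) using LocalizedModule.induction_on with
    | h m s =>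
      rw [cechMap_apply_of_eq_mk x π (g • w) σ (m := g • m) (s := s) (by
        rw [Pi.smul_apply, hs, LocalizedModule.smul'_mk]), (hker _).mpr ⟨m, rfl⟩,
        LocalizedModule.zero_mk]; rfl
  have hb' := h i (by omega) _ hb
  have e : cechMap x i π b = cechMap x i π (b - g • w) := by rw [map_sub, hgw, sub_zero]
  rw [e]
  cases i with
  | zero =>
    have h0 : b - g • w = 0 := hb'
    rw [h0, map_zero]; exact zero_mem _
  | succ i =>
    obtain ⟨a, ha⟩ := hb'
    exact ⟨cechMap x i π a, by rw [cechD_cechMap, ha]⟩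

/-- If `x j` is `M`-regular and the cohomology of `M / x j M` vanishes in degrees `< n`, that of
`M` vanishes in degrees `< n + 1`. -/
theorem CechVanish.of_quotient [Finite ι] {n : ℕ} {j : ι} (hj : IsSMulRegular M (x j))
    {π : M →ₗ[A] N} (hπ : Function.Surjective π) (hker : ∀ m, π m = 0 ↔ ∃ m', x j • m' = m)
    (h : CechVanish x N n) : CechVanish x M (n + 1) := by
  intro i hi c hc
  cases i with
  | zero =>
    obtain ⟨m, hm⟩ := exists_pow_smul_eq_zero_of_cechD_zero x j hc
    have : c = 0 := cechCochain_smul_injective x _ (hj.pow m) (by rw [hm, smul_zero])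
    rw [this]; exact zero_mem _
  | succ i =>
    -- This is injectivity of `x j` on cohomology: its kernel is the image of the cohomology of `N`
    -- one degree lower, which vanishes. As every class is killed by a power of `x j`, every class
    -- is zero.
    have key : ∀ z : CechCochain x M (i + 1), x j • z ∈ LinearMap.range (cechD x M i) →
        z ∈ LinearMap.range (cechD x M i) := by
      rintro z ⟨b, hb⟩
      have h1 : cechD x N i (cechMap x i π b) = 0 := by
        rw [cechD_cechMap, hb]
        funext σ
        induction hs : (z σ) using LocalizedModule.induction_on with
        | h m s =>
          rw [cechMap_apply_of_eq_mk x π (x j • z) σ (m := x j • m) (s := s) (by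
            rw [Pi.smul_apply, hs, LocalizedModule.smul'_mk]), (hker _).mpr ⟨m, rfl⟩,
            LocalizedModule.zero_mk]; rfl
      have h2 := h i (by omega) _ h1
      obtain ⟨a, ha, hba⟩ : ∃ a : CechCochain x M i, cechD x M i a = 0 ∧
          cechMap x i π (b - a) = 0 := by
        cases i with
        | zero =>
          have h3 : cechMap x 0 π b = 0 := h2
          exact ⟨0, map_zero _, by rw [sub_zero, h3]⟩
        | succ i =>
          obtain ⟨a', ha'⟩ := h2
          obtain ⟨a, rfl⟩ := cechMap_surjective x i hπ a'
          exact ⟨cechD x M i a, cechD_cechD x a, by rw [map_sub, ← cechD_cechMap, ha', sub_self]⟩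
      obtain ⟨e, he⟩ := exists_smul_of_cechMap_eq_zero x (fun m => (hker m).mp) hba
      refine ⟨e, cechCochain_smul_injective x _ hj ?_⟩
      rw [← map_smul, he, map_sub, ha, sub_zero, hb]
    obtain ⟨m, b, hb⟩ := exists_pow_smul_mem_range_cechD x j hc
    have hm : x j ^ m • c ∈ LinearMap.range (cechD x M i) := ⟨b, hb⟩
    change c ∈ LinearMap.range (cechD x M i)
    clear hb b
    induction m with
    | zero => simpa using hm
    | succ m ih => exact ih (key _ (by rwa [smul_smul, ← pow_succ']))

/-- A weakly regular sequence of members of the family `x` forces vanishing below its length. -/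
theorem cechVanish_of_isWeaklyRegular [Finite ι] (rs : List A) :
    ∀ {M : Type*} [AddCommGroup M] [Module A M], RingTheory.Sequence.IsWeaklyRegular M rs →
      (∀ r ∈ rs, r ∈ Set.range x) → CechVanish x M rs.length := by
  induction rs with
  | nil => intro M _ _ _ _ i hi; exact absurd hi (by simp)
  | cons r rs ih =>
    intro M _ _ h hr
    obtain ⟨h1, h2⟩ := (RingTheory.Sequence.isWeaklyRegular_cons_iff M r rs).mp h
    obtain ⟨j, rfl⟩ := hr r (by simp)
    refine CechVanish.of_quotient x h1 (π := Submodule.mkQ _) (Submodule.mkQ_surjective _) ?_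
      (ih h2 fun r' hr' => hr r' (by simp [hr']))
    intro m
    rw [Submodule.mkQ_apply, Submodule.Quotient.mk_eq_zero,
      Submodule.mem_smul_pointwise_iff_exists]
    simp

end CechGeneral

/-! ### Čech depth and heights of associated primes. -/

section AssociatedPrimes

open scoped Pointwise

variable {ι : Type*} [LinearOrder ι] {A : Type*} [CommRing A] (x : ι → A)

/-- If the zeroth Čech cohomology vanishes, no nonzero element is killed by all the `x j`. -/
theorem CechVanish.eq_zero_of_smul_eq_zero {M : Type*} [AddCommGroup M] [Module A M] {n : ℕ}
    (h : CechVanish x M (n + 1)) {m : M} (hm : ∀ j, x j • m = 0) : m = 0 := by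
  let c : CechCochain x M 0 := fun σ => LocalizedModule.mk m 1
  have hc : cechD x M 0 c = 0 := by
    funext τ
    rw [cechD_apply]
    refine Finset.sum_eq_zero fun j hj => ?_
    have h1 : cechPush x c τ.1 (τ.1.erase j) = 0 := by
      rw [cechPush, dif_pos ⟨by rw [Finset.card_erase_of_mem hj, τ.2], τ.1.erase_subset _⟩,
        cechRes_mk, ← LocalizedModule.zero_mk 1, LocalizedModule.mk_eq]
      refine ⟨⟨x j, Submonoid.subset_closure ⟨j, hj, rfl⟩⟩, ?_⟩
      rw [one_smul, smul_zero, smul_zero]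
      exact hm j
    rw [h1, smul_zero]
  have h0 : c = 0 := h 0 (Nat.succ_pos n) c hc
  have h1 := congrFun h0 ⟨∅, rfl⟩
  rw [Pi.zero_apply, ← LocalizedModule.zero_mk 1, LocalizedModule.mk_eq] at h1
  obtain ⟨⟨u, hu⟩, hum⟩ := h1
  have hu1 : u = 1 := by simpa [cechSubmonoid] using hu
  subst hu1
  simpa [Submonoid.smul_def] using hum

/-- Otherwise prime avoidance puts `(x)` inside some associated prime, the annihilator of an element
`m`. Then all `x j` kill `m`, which forces `m = 0`. -/
theorem exists_isSMulRegular_of_cechVanish [IsNoetherianRing A] {M : Type*} [AddCommGroup M]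
    [Module A M] [Module.Finite A M] {n : ℕ} (h : CechVanish x M (n + 1)) :
    ∃ z ∈ Ideal.span (Set.range x), IsSMulRegular M z := by
  by_contra! hcon
  have hsub : ((Ideal.span (Set.range x) : Ideal A) : Set A) ⊆
      ⋃ p ∈ ((associatedPrimes.finite A M).toFinset : Set (Ideal A)), (p : Set A) := by
    intro z hz
    have h1 := hcon z hz
    rw [isSMulRegular_iff_right_eq_zero_of_smul] at h1
    push Not at h1
    obtain ⟨m, hm, hm0⟩ := h1
    have : z ∈ ⋃ p ∈ associatedPrimes A M, (p : Set A) := by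
      rw [biUnion_associatedPrimes_eq_zero_divisors]; exact ⟨m, hm0, hm⟩
    simpa using this
  obtain ⟨p, hp, hle⟩ := (Ideal.subset_union_prime (f := fun p : Ideal A => p) ⊤ ⊤ (by
    intro p hp _ _
    exact ((associatedPrimes.finite A M).mem_toFinset.mp hp).1)).mp hsub
  obtain ⟨hpp, m, rfl⟩ := isAssociatedPrime_iff.mp ((associatedPrimes.finite A M).mem_toFinset.mp hp)
  have hm : m = 0 := h.eq_zero_of_smul_eq_zero x fun j => by
    simpa using hle (Ideal.subset_span ⟨j, rfl⟩)
  exact hpp.ne_top (by simp [hm])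

/-- If `z` is `M`-regular and `p ∈ Ass M`, both inside the prime `𝔫`, then some associated prime
of `M / zM` inside `𝔫` strictly contains `p`. -/
theorem exists_associatedPrime_quotient_gt [IsNoetherianRing A] {M : Type*} [AddCommGroup M]
    [Module A M] [Module.Finite A M] {z : A} (hz : IsSMulRegular M z) {𝔫 : Ideal A} [𝔫.IsPrime]
    (hz𝔫 : z ∈ 𝔫) {p : Ideal A} (hp : p ∈ associatedPrimes A M) (hp𝔫 : p ≤ 𝔫) :
    ∃ q ∈ associatedPrimes A (QuotSMulTop z M), p < q ∧ q ≤ 𝔫 := by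
  obtain ⟨hpp, y, hy⟩ := isAssociatedPrime_iff.mp hp
  have hzp : z ∉ p := by
    intro h
    rw [hy] at h
    have hy0 : y = 0 := hz (by simpa using h)
    exact hpp.ne_top (by rw [hy, hy0]; simp)
  -- `L = (0 :_M p)`. It suffices to find `m ∈ L` whose class in `M / zM` has annihilator inside
  -- `𝔫`: a minimal prime over that annihilator contains both `p` and `z`.
  let L : Submodule A M := Submodule.torsionBySet A M p
  have hLy : y ∈ L := by
    rw [Submodule.mem_torsionBySet_iff]
    rintro ⟨a, ha⟩
    have ha' : a ∈ p := ha
    rw [hy] at ha'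
    simpa using ha'
  have hL : ∀ m ∈ L, ∀ a ∈ p, a • m = 0 := fun m hm a ha =>
    (Submodule.mem_torsionBySet_iff _ _).mp hm ⟨a, ha⟩
  obtain ⟨m, hmL, hm⟩ : ∃ m ∈ L,
      (⊥ : Submodule A (QuotSMulTop z M)).colon {Submodule.Quotient.mk m} ≤ 𝔫 := by
    by_contra! hcon
    -- If no such `m` exists, then `L` equals `zL` locally at `𝔫`, contrary to Nakayama. The
    -- quotient `m'` stays in `L` because `z` is regular.
    have h1 : ∀ m ∈ L, ∃ a ∉ 𝔫, ∃ m' ∈ L, z • m' = a • m := by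
      intro m hm
      obtain ⟨a, ha, ha𝔫⟩ := SetLike.not_le_iff_exists.mp (hcon m hm)
      refine ⟨a, ha𝔫, ?_⟩
      rw [Submodule.mem_colon_singleton, Submodule.mem_bot, ← Submodule.Quotient.mk_smul,
        Submodule.Quotient.mk_eq_zero, Submodule.mem_smul_pointwise_iff_exists] at ha
      obtain ⟨m', -, hm'⟩ := ha
      refine ⟨m', (Submodule.mem_torsionBySet_iff _ _).mpr fun b => hz ?_, hm'⟩
      change z • (b : A) • m' = z • 0
      rw [smul_comm, hm', smul_comm, hL m hm b b.2, smul_zero, smul_zero]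
    obtain ⟨s, hs⟩ : L.FG := IsNoetherian.noetherian L
    choose! a ha m' hm' hm'' using h1
    have hsL : ∀ m ∈ s, m ∈ L := fun m hm => hs ▸ Submodule.subset_span hm
    have hb𝔫 : ∏ m ∈ s, a m ∉ 𝔫 := by
      rw [Ideal.IsPrime.prod_mem_iff]
      rintro ⟨m, hm, h⟩
      exact ha m (hsL m hm) h
    set b := ∏ m ∈ s, a m with hb
    have hbL : ∀ m ∈ L, ∃ m' ∈ L, z • m' = b • m := by
      intro m hm
      rw [← hs] at hm
      induction hm using Submodule.span_induction with
      | mem m hm =>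
        obtain ⟨c, hc⟩ : a m ∣ b := Finset.dvd_prod_of_mem a hm
        refine ⟨c • m' m, L.smul_mem _ (hm' m (hsL m hm)), ?_⟩
        rw [smul_comm, hm'' m (hsL m hm), hc, smul_smul, mul_comm]
      | zero => exact ⟨0, L.zero_mem, by simp⟩
      | add u v _ _ hu hv =>
        obtain ⟨u', hu', hu⟩ := hu
        obtain ⟨v', hv', hv⟩ := hv
        exact ⟨u' + v', L.add_mem hu' hv', by rw [smul_add, smul_add, hu, hv]⟩
      | smul c u _ hu =>
        obtain ⟨u', hu', hu⟩ := hu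
        exact ⟨c • u', L.smul_mem c hu', by rw [smul_comm, hu, smul_comm]⟩
    -- Nakayama without localizing: since `bL ⊆ zL`, the determinant trick gives a monic `P` with
    -- `P(b)` zero on `L` and lower coefficients in `(z)`. Applied to `y` it gives `P(b) ∈ p ≤ 𝔫`,
    -- hence a power of `b` in `𝔫`, although `b ∉ 𝔫`.
    obtain ⟨P, hPm, -, hPc, hP⟩ :=
      LinearMap.exists_monic_and_natDegree_eq_and_coeff_mem_pow_and_aeval_eq_zero A
        (algebraMap A (Module.End A L) b) (Ideal.span {z}) (by
          rintro _ ⟨m, rfl⟩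
          obtain ⟨u, hu, hu'⟩ := hbL m m.2
          rw [Submodule.ideal_span_singleton_smul, Submodule.mem_smul_pointwise_iff_exists]
          exact ⟨⟨u, hu⟩, trivial, Subtype.ext hu'⟩)
    have h2 : P.eval b ∈ p := by
      rw [Polynomial.aeval_algebraMap_apply, Polynomial.coe_aeval_eq_eval] at hP
      have h3 := congrArg Subtype.val (LinearMap.congr_fun hP ⟨y, hLy⟩)
      rw [hy, Submodule.mem_colon_singleton, Submodule.mem_bot]
      exact h3
    have h3 : P.eval b ∈ 𝔫 := hp𝔫 h2
    rw [Polynomial.eval_eq_sum_range, Finset.sum_range_succ, hPm.coeff_natDegree, one_mul] at h3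
    have h4 : ∑ i ∈ Finset.range P.natDegree, P.coeff i * b ^ i ∈ 𝔫 := by
      refine sum_mem fun i hi => Ideal.mul_mem_right _ _ ?_
      have h5 := Ideal.pow_le_self (I := Ideal.span {z})
        (n := P.natDegree - i) (by have := Finset.mem_range.mp hi; omega) (hPc i)
      exact (Ideal.span_singleton_le_iff_mem (I := 𝔫)).mpr hz𝔫 h5
    exact hb𝔫 (Ideal.IsPrime.mem_of_pow_mem ‹_› _ ((Ideal.add_mem_iff_right _ h4).mp h3))
  obtain ⟨q, hq, hq𝔫⟩ := Ideal.exists_minimalPrimes_le hm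
  have hqp : q.IsPrime := hq.1.1
  refine ⟨q, isAssociatedPrime_iff.mpr ⟨hqp, Submodule.exists_eq_colon_of_mem_minimalPrimes hq⟩,
    lt_of_le_of_ne ?_ ?_, hq𝔫⟩
  · intro a ha
    refine hq.1.2 ?_
    rw [Submodule.mem_colon_singleton, Submodule.mem_bot, ← Submodule.Quotient.mk_smul,
      hL m hmL a ha, Submodule.Quotient.mk_zero]
  · rintro rfl
    refine hzp (hq.1.2 ?_)
    rw [Submodule.mem_colon_singleton, Submodule.mem_bot, ← Submodule.Quotient.mk_smul,
      Submodule.Quotient.mk_eq_zero]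
    exact Submodule.smul_mem_pointwise_smul _ _ _ trivial

/-- Vanishing of the Čech cohomology below `n` bounds the height of the associated primes. -/
theorem height_add_le_of_cechVanish [IsNoetherianRing A] {𝔫 : Ideal A} [𝔫.IsPrime]
    (hx : ∀ j, x j ∈ 𝔫) (n : ℕ) : ∀ {M : Type*} [AddCommGroup M] [Module A M] [Module.Finite A M],
    CechVanish x M n → ∀ p ∈ associatedPrimes A M, p ≤ 𝔫 → p.height + n ≤ 𝔫.height := by
  induction n with
  | zero => intro M _ _ _ _ p _ hp; simpa using Ideal.height_mono hp
  | succ n ih =>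
    intro M _ _ _ h p hp hp𝔫
    obtain ⟨z, hz, hreg⟩ := exists_isSMulRegular_of_cechVanish x h
    have hz𝔫 : z ∈ 𝔫 := (Ideal.span_le.mpr (by rintro _ ⟨j, rfl⟩; exact hx j)) hz
    -- Passing to `M / zM` costs one degree of vanishing and gains one in height, since `q` is
    -- strictly above `p`.
    obtain ⟨q, hq, hpq, hq𝔫⟩ := exists_associatedPrime_quotient_gt hreg hz𝔫 hp hp𝔫
    have := hp.1
    have := hq.1
    have h1 := ih (h.quotient x hreg (π := Submodule.mkQ (z • (⊤ : Submodule A M)))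
      (Submodule.mkQ_surjective _) fun m => by
        rw [Submodule.mkQ_apply, Submodule.Quotient.mk_eq_zero,
          Submodule.mem_smul_pointwise_iff_exists]
        simp) q hq hq𝔫
    calc p.height + ((n + 1 : ℕ) : ℕ∞) = (p.height + 1) + n := by push_cast; ring
      _ ≤ q.height + n := by gcongr; exact Ideal.height_add_one_le_of_lt_of_isPrime hpq
      _ ≤ _ := h1

end AssociatedPrimes

/-! ### Regular sequences in polynomial rings. -/

section RegularSequences

open RingTheory.Sequence

theorem isWeaklyRegular_map_ringEquiv {A B : Type*} [CommRing A] [CommRing B] (e : A ≃+* B)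
    {rs : List A} (h : IsWeaklyRegular A rs) : IsWeaklyRegular B (rs.map e) :=
  (AddEquiv.isWeaklyRegular_congr (e := e.toAddEquiv) (List.forall₂_map_right_iff.mpr
    (List.forall₂_same.mpr fun r _ a => by simp))).mp h

/-- Flatness of `A[X]` handles `rs`; `f` stays monic over `A/(rs)`, hence is not a zero divisor
there. -/
theorem isWeaklyRegular_map_C_append_monic {A : Type*} [CommRing A] {rs : List A}
    (h : IsWeaklyRegular A rs) {f : Polynomial A} (hf : f.Monic) :
    IsWeaklyRegular (Polynomial A) (rs.map Polynomial.C ++ [f]) := by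
  rw [isWeaklyRegular_append_iff, isWeaklyRegular_singleton_iff]
  refine ⟨h.of_flat (S := Polynomial A), ?_⟩
  rw [isSMulRegular_iff_right_eq_zero_of_smul]
  intro a
  obtain ⟨a, rfl⟩ := Submodule.Quotient.mk_surjective _ a
  rw [← Submodule.Quotient.mk_smul, Submodule.Quotient.mk_eq_zero, Submodule.Quotient.mk_eq_zero]
  have e : Ideal.ofList (rs.map Polynomial.C) • (⊤ : Submodule (Polynomial A) (Polynomial A)) =
      (Ideal.ofList rs).map Polynomial.C := by
    rw [Ideal.map_ofList, smul_eq_mul]; exact Ideal.mul_top _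
  rw [e]
  have key : ∀ b : Polynomial A, b ∈ (Ideal.ofList rs).map Polynomial.C ↔
      b.map (Ideal.Quotient.mk (Ideal.ofList rs)) = 0 := by
    intro b
    rw [Ideal.mem_map_C_iff, Polynomial.ext_iff]
    simp [Ideal.Quotient.eq_zero_iff_mem]
  rw [key, key, smul_eq_mul, Polynomial.map_mul]
  intro h0
  exact (hf.map _).mul_right_eq_zero_iff.mp h0

/-- Every maximal ideal of `A` contains a weakly regular sequence of length `n`. -/
def MaximalIdealsHaveRegularSequence (A : Type*) [CommRing A] (n : ℕ) : Prop :=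
  ∀ 𝔫 : Ideal A, 𝔫.IsMaximal → ∃ rs : List A, rs.length = n ∧ IsWeaklyRegular A rs ∧ ∀ r ∈ rs, r ∈ 𝔫

theorem MaximalIdealsHaveRegularSequence.of_ringEquiv {A B : Type*} [CommRing A] [CommRing B]
    (e : A ≃+* B) {n : ℕ} (h : MaximalIdealsHaveRegularSequence A n) :
    MaximalIdealsHaveRegularSequence B n := by
  intro 𝔫 h𝔫
  obtain ⟨rs, hl, hr, hm⟩ := h (𝔫.comap e) (Ideal.comap_isMaximal_of_surjective e e.surjective)
  refine ⟨rs.map e, by simpa using hl, isWeaklyRegular_map_ringEquiv e hr, ?_⟩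
  simp only [List.mem_map]
  rintro _ ⟨r, hr, rfl⟩
  exact hm r hr

/-- Over a Jacobson ring a maximal ideal of `A[X]` contracts to a maximal ideal of `A`, and it
contains a monic polynomial to append to the sequence found there. -/
theorem MaximalIdealsHaveRegularSequence.polynomial {A : Type*} [CommRing A] [IsJacobsonRing A]
    {n : ℕ} (h : MaximalIdealsHaveRegularSequence A n) :
    MaximalIdealsHaveRegularSequence (Polynomial A) (n + 1) := by
  intro 𝔫 h𝔫
  have hmax : (𝔫.comap (Polynomial.C : A →+* Polynomial A)).IsMaximal :=
    Polynomial.isMaximal_comap_C_of_isJacobsonRing 𝔫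
  obtain ⟨rs, hl, hr, hm⟩ := h _ hmax
  -- An extended ideal contains every coefficient of its elements. It cannot contain `X`, nor can
  -- `X` be invertible modulo it: `1 - X b` has constant coefficient `1`.
  have hne : 𝔫 ≠ (𝔫.comap Polynomial.C).map Polynomial.C := by
    intro heq
    have h1 : ∀ f ∈ 𝔫, ∀ i, f.coeff i ∈ 𝔫.comap Polynomial.C := by
      intro f hf
      rw [heq] at hf
      exact Ideal.mem_map_C_iff.mp hf
    by_cases hX : (Polynomial.X : Polynomial A) ∈ 𝔫
    · exact hmax.ne_top ((Ideal.eq_top_iff_one _).mpr (by simpa using h1 _ hX 1))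
    · obtain ⟨a, b, hb, hab⟩ := h𝔫.exists_inv hX
      have h2 := h1 b hb 0
      have h3 : b.coeff 0 = 1 := by
        rw [eq_sub_of_add_eq' hab]; simp
      rw [h3] at h2
      exact hmax.ne_top ((Ideal.eq_top_iff_one _).mpr h2)
  obtain ⟨f, hf, hf𝔫⟩ := Polynomial.exists_monic_span_sup_map_eq A 𝔫 hmax hne
  refine ⟨rs.map Polynomial.C ++ [f], by simp [hl], isWeaklyRegular_map_C_append_monic hr hf, ?_⟩
  intro r hr'
  rcases List.mem_append.mp hr' with hr' | hr'
  · obtain ⟨a, ha, rfl⟩ := List.mem_map.mp hr'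
    exact hm a ha
  · rw [List.mem_singleton.mp hr', hf𝔫]
    exact Ideal.mem_sup_right (Ideal.mem_span_singleton_self f)

theorem MaximalIdealsHaveRegularSequence.mvPolynomial {A : Type*} [CommRing A] [IsJacobsonRing A]
    {n : ℕ} (h : MaximalIdealsHaveRegularSequence A n) (m : ℕ) :
    MaximalIdealsHaveRegularSequence (MvPolynomial (Fin m) A) (n + m) := by
  induction m with
  | zero => exact h.of_ringEquiv (MvPolynomial.isEmptyRingEquiv A (Fin 0)).symm
  | succ m ih => exact ih.polynomial.of_ringEquiv (MvPolynomial.finSuccEquiv A m).symm.toRingEquiv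

theorem exists_isWeaklyRegular_X (A : Type*) [CommRing A] (m : ℕ) :
    ∃ rs : List (MvPolynomial (Fin m) A), rs.length = m ∧
      IsWeaklyRegular (MvPolynomial (Fin m) A) rs ∧ ∀ r ∈ rs, r ∈ Set.range MvPolynomial.X := by
  induction m with
  | zero => exact ⟨[], rfl, .nil _ _, by simp⟩
  | succ m ih =>
    obtain ⟨rs, hl, hr, hm⟩ := ih
    refine ⟨_, ?_, isWeaklyRegular_map_ringEquiv (MvPolynomial.finSuccEquiv A m).symm.toRingEquiv
      (isWeaklyRegular_map_C_append_monic hr Polynomial.monic_X), ?_⟩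
    · simp [hl]
    · intro r hr'
      simp only [List.map_append, List.map_map, List.mem_append, List.mem_map, List.map_cons,
        List.map_nil, List.mem_singleton, Function.comp_apply] at hr'
      rcases hr' with ⟨a, ha, rfl⟩ | rfl
      · obtain ⟨j, rfl⟩ := hm a ha
        exact ⟨j.succ, by
          change _ = (MvPolynomial.finSuccEquiv A m).symm _
          rw [AlgEquiv.eq_symm_apply, MvPolynomial.finSuccEquiv_X_succ]⟩
      · exact ⟨0, by
          change _ = (MvPolynomial.finSuccEquiv A m).symm _
          rw [AlgEquiv.eq_symm_apply, MvPolynomial.finSuccEquiv_X_zero]⟩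

variable (k : Type*) [Field k] (d : ℕ)

theorem maximalIdealsHaveRegularSequence_polyS :
    MaximalIdealsHaveRegularSequence (PolyS k d) (d + (d + 1)) := by
  have h0 : MaximalIdealsHaveRegularSequence k 0 := fun _ _ => ⟨[], rfl, .nil _ _, by simp⟩
  have h1 := h0.mvPolynomial d
  rw [zero_add] at h1
  exact h1.mvPolynomial (d + 1)

theorem cechVanish_polyS : CechVanish (xS k d) (PolyS k d) d := by
  obtain ⟨rs, hl, hr, hm⟩ := exists_isWeaklyRegular_X k d
  have h := cechVanish_of_isWeaklyRegular (xS k d) _ (hr.of_flat (S := PolyS k d)) (by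
    simp only [List.mem_map]
    rintro _ ⟨r, hr, rfl⟩
    obtain ⟨j, rfl⟩ := hm r hr
    exact ⟨j, rfl⟩)
  rwa [List.length_map, hl] at h

end RegularSequences

/-! ### Linear forms over residue fields, heights, and ranks of a presentation matrix. -/

section LinearForms

/-- Mapping to the polynomial ring on a basis of `V` lets the coordinates of `v` be read off as
coefficients. -/
theorem symmetricAlgebra_ι_injective (K V : Type*) [Field K] [AddCommGroup V] [Module K V] :
    Function.Injective (SymmetricAlgebra.ι K V) := by
  classical
  let b := Module.Basis.ofVectorSpace K V
  rw [injective_iff_map_eq_zero]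
  intro v hv
  have h1 : Module.Basis.constr b K (MvPolynomial.X (R := K)) v = 0 := by
    rw [← SymmetricAlgebra.lift_ι_apply (Module.Basis.constr b K (MvPolynomial.X (R := K))) v, hv,
      map_zero]
  rw [Module.Basis.constr_apply, Finsupp.sum] at h1
  have h2 : ∀ i, b.repr v i = 0 := by
    intro i
    have h3 := congrArg (MvPolynomial.coeff (Finsupp.single i 1)) h1
    simp only [MvPolynomial.coeff_sum, MvPolynomial.coeff_smul, MvPolynomial.X,
      MvPolynomial.coeff_monomial,
      MvPolynomial.coeff_zero, smul_eq_mul] at h3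
    by_contra h4
    rw [Finset.sum_eq_single i] at h3
    · simp at h3; exact h4 h3
    · intro j _ hj
      rw [if_neg (fun h => hj (Finsupp.single_left_injective one_ne_zero h)), mul_zero]
    · intro hi; exact absurd (Finsupp.notMem_support_iff.mp hi) h4
  exact b.repr.map_eq_zero_iff.mp (Finsupp.ext h2)

variable {R : Type*} [CommRing R] {n : ℕ} (p : Ideal R) [p.IsPrime]

/-- The linear form `∑ a_i T_i`. -/
def linearForm (a : Fin n → R) : MvPolynomial (Fin n) R :=
  ∑ i, MvPolynomial.C (a i) * MvPolynomial.X i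

/-- The reduction of a vector modulo `p`. -/
def residueVec (a : Fin n → R) : Fin n → p.ResidueField := fun i => algebraMap R p.ResidueField (a i)

/-- The map `R[T] → κ(p)[T] → Sym(κ(p)ⁿ / W)`. -/
def linearQuotMap (W : Submodule p.ResidueField (Fin n → p.ResidueField)) :
    MvPolynomial (Fin n) R →+*
      SymmetricAlgebra p.ResidueField ((Fin n → p.ResidueField) ⧸ W) :=
  MvPolynomial.eval₂Hom ((algebraMap p.ResidueField _).comp (algebraMap R p.ResidueField))
    fun i => SymmetricAlgebra.ι _ _ (Submodule.Quotient.mk (Pi.single i 1))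

/-- The prime ideal of `R[T]` over `p` cut out by the linear forms in `W`. -/
def linearPrime (W : Submodule p.ResidueField (Fin n → p.ResidueField)) :
    Ideal (MvPolynomial (Fin n) R) := RingHom.ker (linearQuotMap p W)

/-- The symmetric algebra of a vector space is a domain. -/
instance (W : Submodule p.ResidueField (Fin n → p.ResidueField)) : (linearPrime p W).IsPrime :=
  RingHom.ker_isPrime _

theorem linearQuotMap_linearForm (W : Submodule p.ResidueField (Fin n → p.ResidueField))
    (a : Fin n → R) : linearQuotMap p W (linearForm a) =
      SymmetricAlgebra.ι _ _ (Submodule.Quotient.mk (residueVec p a)) := by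
  have h : residueVec p a = ∑ i, residueVec p a i • (Pi.single i 1 : Fin n → p.ResidueField) := by
    rw [← Finset.univ_sum_single (residueVec p a)]
    refine Finset.sum_congr rfl fun i _ => ?_
    rw [← Pi.single_smul]; simp
  rw [h, ← Submodule.mkQ_apply, map_sum, map_sum, linearForm, map_sum]
  refine Finset.sum_congr rfl fun i _ => ?_
  rw [map_smul, map_smul, map_mul, linearQuotMap, MvPolynomial.coe_eval₂Hom,
    MvPolynomial.eval₂_C, MvPolynomial.eval₂_X, Algebra.smul_def]
  rfl

theorem linearForm_mem_linearPrime {W : Submodule p.ResidueField (Fin n → p.ResidueField)}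
    {a : Fin n → R} : linearForm a ∈ linearPrime p W ↔ residueVec p a ∈ W := by
  rw [linearPrime, RingHom.mem_ker, linearQuotMap_linearForm,
    (symmetricAlgebra_ι_injective _ _).eq_iff' (map_zero _), Submodule.Quotient.mk_eq_zero]

theorem comap_linearPrime (W : Submodule p.ResidueField (Fin n → p.ResidueField)) :
    (linearPrime p W).comap MvPolynomial.C = p := by
  ext a
  rw [Ideal.mem_comap, linearPrime, RingHom.mem_ker, linearQuotMap, MvPolynomial.coe_eval₂Hom,
    MvPolynomial.eval₂_C, RingHom.comp_apply,
    map_eq_zero_iff _ (algebraMap p.ResidueField _).injective, Ideal.algebraMap_residueField_eq_zero]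

/-- Such an `α` factors through `linearQuotMap p W`, by the universal property of the symmetric
algebra. -/
theorem linearPrime_le_ker {Ω : Type*} [CommRing Ω] (α : MvPolynomial (Fin n) R →+* Ω)
    (β : p.ResidueField →+* Ω) (hαβ : ∀ a, α (MvPolynomial.C a) = β (algebraMap R _ a))
    (W : Submodule p.ResidueField (Fin n → p.ResidueField))
    (hW : ∀ w ∈ W, ∑ i, β (w i) * α (MvPolynomial.X i) = 0) :
    linearPrime p W ≤ RingHom.ker α := by
  algebraize [β]
  let ℓ : (Fin n → p.ResidueField) →ₗ[p.ResidueField] Ω :=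
    Fintype.linearCombination p.ResidueField fun i => α (MvPolynomial.X i)
  have hℓ : W ≤ LinearMap.ker ℓ := by
    intro w hw
    rw [LinearMap.mem_ker, Fintype.linearCombination_apply, ← hW w hw]
    exact Finset.sum_congr rfl fun i _ => Algebra.smul_def _ _
  let γ := SymmetricAlgebra.lift (W.liftQ ℓ hℓ)
  have hγ : γ.toRingHom.comp (linearQuotMap p W) = α := by
    refine MvPolynomial.ringHom_ext (fun a => ?_) fun i => ?_
    · rw [hαβ, RingHom.comp_apply, linearQuotMap, MvPolynomial.coe_eval₂Hom, MvPolynomial.eval₂_C,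
        RingHom.comp_apply]
      exact γ.commutes _
    · rw [RingHom.comp_apply, linearQuotMap, MvPolynomial.coe_eval₂Hom, MvPolynomial.eval₂_X]
      change γ _ = _
      rw [SymmetricAlgebra.lift_ι_apply, Submodule.liftQ_apply]
      simp [ℓ]
  intro s hs
  rw [RingHom.mem_ker, ← hγ, RingHom.comp_apply, (RingHom.mem_ker).mp hs, map_zero]

theorem exists_residueVec_eq_smul (w : Fin n → p.ResidueField) :
    ∃ (c : p.ResidueField) (a : Fin n → R), c ≠ 0 ∧ residueVec p a = c • w := by
  obtain ⟨b, hb⟩ := IsLocalization.exist_integer_multiples_of_finite (nonZeroDivisors (R ⧸ p)) w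
  choose a ha using hb
  choose a' ha' using fun i => Ideal.Quotient.mk_surjective (a i)
  refine ⟨algebraMap (R ⧸ p) _ b, a', ?_, ?_⟩
  · exact IsLocalization.to_map_ne_zero_of_mem_nonZeroDivisors _ le_rfl b.2
  · funext i
    rw [Pi.smul_apply, smul_eq_mul, ← Algebra.smul_def, ← ha, ← ha']
    rfl

theorem linearPrime_mono {W W' : Submodule p.ResidueField (Fin n → p.ResidueField)} (h : W ≤ W') :
    linearPrime p W ≤ linearPrime p W' := by
  refine linearPrime_le_ker p (linearQuotMap p W') (algebraMap p.ResidueField _) (fun a => ?_) W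
    fun w hw => ?_
  · rw [linearQuotMap, MvPolynomial.coe_eval₂Hom, MvPolynomial.eval₂_C]; rfl
  · obtain ⟨c, a, hc, ha⟩ := exists_residueVec_eq_smul p w
    have h1 : linearQuotMap p W' (linearForm a) = 0 := by
      refine (linearForm_mem_linearPrime p).mpr ?_
      rw [ha]; exact W'.smul_mem c (h hw)
    have h2 : algebraMap p.ResidueField _ c * ∑ i, algebraMap p.ResidueField _ (w i) *
        linearQuotMap p W' (MvPolynomial.X i) = 0 := by
      rw [← h1, linearForm, map_sum, Finset.mul_sum]
      refine Finset.sum_congr rfl fun i _ => ?_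
      have e : c * w i = residueVec p a i := by rw [ha]; rfl
      rw [map_mul, ← mul_assoc, ← map_mul, e]
      congr 1
      rw [linearQuotMap, MvPolynomial.coe_eval₂Hom, MvPolynomial.eval₂_C]; rfl
    refine (mul_eq_zero.mp h2).resolve_left ?_
    rwa [map_eq_zero_iff _ (algebraMap p.ResidueField _).injective]

/-- After clearing denominators, a vector of `W'` outside `W` becomes a linear form over `R` that
separates the two primes. -/
theorem linearPrime_strictMono {W W' : Submodule p.ResidueField (Fin n → p.ResidueField)}
    (h : W < W') : linearPrime p W < linearPrime p W' := by
  refine lt_of_le_of_ne (linearPrime_mono p h.le) fun heq => ?_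
  obtain ⟨w, hw', hw⟩ := SetLike.exists_of_lt h
  obtain ⟨c, a, hc, ha⟩ := exists_residueVec_eq_smul p w
  have h1 : linearForm a ∈ linearPrime p W' := by
    rw [linearForm_mem_linearPrime, ha]; exact W'.smul_mem c hw'
  rw [← heq, linearForm_mem_linearPrime, ha] at h1
  exact hw ((W.smul_mem_iff hc).mp h1)

/-- Going down for the flat extension `R → R[T]`. -/
theorem height_le_height_of_comap_C [IsNoetherianRing R] (Q : Ideal (MvPolynomial (Fin n) R))
    [Q.IsPrime] (h : Q.comap MvPolynomial.C = p) : p.height ≤ Q.height := by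
  have : Q.LiesOver p := ⟨h.symm⟩
  rw [Ideal.height_eq_height_add_of_liesOver_of_hasGoingDown p Q]
  exact le_self_add

/-- Adding vectors one at a time gives a chain of primes over `p` with a strict step whenever the
dimension grows. -/
theorem height_add_finrank_le_linearPrime [IsNoetherianRing R]
    (s : Finset (Fin n → p.ResidueField)) :
    p.height + (Module.finrank p.ResidueField (Submodule.span p.ResidueField (s : Set (Fin n → p.ResidueField))) : ℕ) ≤
      (linearPrime p (Submodule.span p.ResidueField (s : Set (Fin n → p.ResidueField)))).height := by
  classical
  induction s using Finset.induction_on with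
  | empty =>
    rw [Finset.coe_empty, Submodule.span_empty, finrank_bot, Nat.cast_zero, add_zero]
    exact height_le_height_of_comap_C p _ (comap_linearPrime p _)
  | insert w s hw ih =>
    rw [Finset.coe_insert]
    by_cases h : w ∈ Submodule.span p.ResidueField (s : Set (Fin n → p.ResidueField))
    · rwa [Submodule.span_insert_eq_span h]
    · have hlt : Submodule.span p.ResidueField (s : Set (Fin n → p.ResidueField)) <
          Submodule.span p.ResidueField (insert w (s : Set (Fin n → p.ResidueField))) := by
        refine lt_of_le_of_ne (Submodule.span_mono (Set.subset_insert _ _)) fun heq => h ?_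
        rw [heq]; exact Submodule.subset_span (Set.mem_insert _ _)
      have h1 := Ideal.height_add_one_le_of_lt_of_isPrime (linearPrime_strictMono p hlt)
      have h2 : Module.finrank p.ResidueField (Submodule.span p.ResidueField
          (insert w (s : Set (Fin n → p.ResidueField)))) ≤
          Module.finrank p.ResidueField (Submodule.span p.ResidueField (s : Set (Fin n → p.ResidueField))) + 1 := by
        rw [Submodule.span_insert, add_comm]
        refine (Submodule.finrank_add_le_finrank_add_finrank _ _).trans ?_
        gcongr
        exact (finrank_span_le_card ({w} : Set (Fin n → p.ResidueField))).trans (by simp)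
      calc p.height + (Module.finrank p.ResidueField (Submodule.span p.ResidueField
            (insert w (s : Set (Fin n → p.ResidueField)))) : ℕ)
          ≤ p.height + ((Module.finrank p.ResidueField
            (Submodule.span p.ResidueField (s : Set (Fin n → p.ResidueField))) + 1 : ℕ) : ℕ∞) := by gcongr
        _ = (p.height + (Module.finrank p.ResidueField
            (Submodule.span p.ResidueField (s : Set (Fin n → p.ResidueField))) : ℕ)) + 1 := by push_cast; ring
        _ ≤ _ := by gcongr
        _ ≤ _ := h1

/-- A prime of `R[T]` over `p` that contains linear forms of rank `t` modulo `p` has height at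
least `ht p + t`. -/
theorem height_add_finrank_le [IsNoetherianRing R] (Q : Ideal (MvPolynomial (Fin n) R)) [Q.IsPrime]
    (hQ : Q.comap MvPolynomial.C = p) {m : Type*} [Finite m] (a : m → Fin n → R)
    (ha : ∀ j, linearForm (a j) ∈ Q) :
    p.height + (Module.finrank p.ResidueField (Submodule.span p.ResidueField
      (Set.range fun j => residueVec p (a j))) : ℕ) ≤ Q.height := by
  classical
  have := Fintype.ofFinite m
  have h1 := height_add_finrank_le_linearPrime p (Finset.univ.image fun j => residueVec p (a j))
  rw [Finset.coe_image, Finset.coe_univ, Set.image_univ] at h1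
  refine h1.trans (Ideal.height_mono ?_)
  have hker : RingHom.ker (algebraMap (MvPolynomial (Fin n) R) Q.ResidueField) = Q :=
    Ideal.ker_algebraMap_residueField Q
  let β := Ideal.ResidueField.map p Q MvPolynomial.C hQ.symm
  have hβ : ∀ a : R, algebraMap (MvPolynomial (Fin n) R) Q.ResidueField (MvPolynomial.C a) =
      β (algebraMap R p.ResidueField a) := fun a =>
    (Ideal.ResidueField.map_algebraMap p Q MvPolynomial.C hQ.symm a).symm
  -- The linear prime of the span lies in `Q`, the kernel of `R[T] → κ(Q)`, because relations over
  -- `κ(p)` persist in `κ(Q)`.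
  refine (linearPrime_le_ker p (algebraMap _ Q.ResidueField) β hβ _ fun w hw => ?_).trans hker.le
  induction hw using Submodule.span_induction with
  | mem w hw =>
    obtain ⟨j, rfl⟩ := hw
    have h2 : algebraMap _ Q.ResidueField (linearForm (a j)) = 0 :=
      Ideal.algebraMap_residueField_eq_zero.mpr (ha j)
    rw [linearForm, map_sum] at h2
    rw [← h2]
    refine Finset.sum_congr rfl fun i _ => ?_
    rw [map_mul, hβ]; rfl
  | zero => simp
  | add u v _ _ hu hv =>
    simp only [Pi.add_apply, map_add, add_mul, Finset.sum_add_distrib, hu, hv, add_zero]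
  | smul c u _ hu =>
    simp only [Pi.smul_apply, smul_eq_mul, map_mul, mul_assoc, ← Finset.mul_sum, hu, mul_zero]

/-! #### Ranks of the presentation matrix -/

/-- If `U` generates the ideal after inverting `c`, then preimages of `U` in `Rⁿ` and the columns of
`φ` together generate `Rⁿ` up to `c`. Modulo `p` they therefore span `κ(p)ⁿ`. -/
theorem le_card_add_finrank_of_smul_mem {m : ℕ} (f : Fin n → R) (φ : Matrix (Fin n) (Fin m) R)
    (hex : Function.Exact φ.mulVecLin (Fintype.linearCombination R f))
    (U : Finset R) (hU : ∀ u ∈ U, u ∈ Ideal.span (Set.range f)) (c : R) (hc : c ∉ p)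
    (hcf : ∀ i, c * f i ∈ Ideal.span (U : Set R)) :
    n ≤ U.card + Module.finrank p.ResidueField (Submodule.span p.ResidueField
      (Set.range fun j => residueVec p fun i => φ i j)) := by
  classical
  have hlin : ∀ u ∈ Ideal.span (Set.range f), ∃ a : Fin n → R,
      Fintype.linearCombination R f a = u := by
    intro u hu
    have h0 : u ∈ LinearMap.range (Fintype.linearCombination R f) := by
      rw [Fintype.range_linearCombination]; exact hu
    exact h0
  choose! v hv using fun u (hu : u ∈ U) => hlin u (hU u hu)
  set X := Submodule.span p.ResidueField (Set.range fun j => residueVec p fun i => φ i j) with hX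
  set Y := Submodule.span p.ResidueField
    ((U.image fun u => residueVec p (v u) : Finset _) : Set (Fin n → p.ResidueField)) with hY
  have hres : ∀ a b : Fin n → R, residueVec p (a + b) = residueVec p a + residueVec p b :=
    fun a b => funext fun i => map_add _ _ _
  have hress : ∀ (r : R) (a : Fin n → R),
      residueVec p (r • a) = algebraMap R p.ResidueField r • residueVec p a :=
    fun r a => funext fun i => map_mul _ _ _
  have key : ∀ w ∈ Ideal.span (U : Set R), ∀ a : Fin n → R,
      Fintype.linearCombination R f a = w → residueVec p a ∈ Y ⊔ X := by
    intro w hw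
    have h1 : ∃ b : Fin n → R, Fintype.linearCombination R f b = w ∧ residueVec p b ∈ Y := by
      induction hw using Submodule.span_induction with
      | mem u hu =>
        exact ⟨v u, hv u hu, Submodule.subset_span (by
          rw [Finset.coe_image]; exact Set.mem_image_of_mem _ hu)⟩
      | zero => exact ⟨0, map_zero _, by
          have : residueVec p (0 : Fin n → R) = 0 := funext fun i => map_zero _
          rw [this]; exact zero_mem _⟩
      | add x y _ _ hx hy =>
        obtain ⟨b, rfl, hb⟩ := hx
        obtain ⟨b', rfl, hb'⟩ := hy
        exact ⟨b + b', map_add _ _ _, by rw [hres]; exact add_mem hb hb'⟩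
      | smul r x _ hx =>
        obtain ⟨b, rfl, hb⟩ := hx
        exact ⟨r • b, map_smul _ _ _, by rw [hress]; exact Y.smul_mem _ hb⟩
    intro a ha
    obtain ⟨b, hb, hbY⟩ := h1
    obtain ⟨t, ht⟩ := (hex (a - b)).mp (by rw [map_sub, ha, hb, sub_self])
    have h2 : residueVec p (φ.mulVecLin t) ∈ X := by
      have : residueVec p (φ.mulVecLin t) =
          ∑ j, algebraMap R p.ResidueField (t j) • residueVec p (fun i => φ i j) := by
        funext i
        simp only [residueVec, Matrix.mulVecLin_apply, Matrix.mulVec, dotProduct, map_sum, map_mul,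
          Finset.sum_apply, Pi.smul_apply, smul_eq_mul]
        exact Finset.sum_congr rfl fun j _ => mul_comm _ _
      rw [this]
      exact sum_mem fun j _ => X.smul_mem _ (Submodule.subset_span ⟨j, rfl⟩)
    have h3 : a = b + φ.mulVecLin t := by rw [ht]; abel
    rw [h3, hres]
    exact add_mem (Submodule.mem_sup_left hbY) (Submodule.mem_sup_right h2)
  have htop : Y ⊔ X = ⊤ := by
    rw [eq_top_iff, ← (Pi.basisFun p.ResidueField (Fin n)).span_eq, Submodule.span_le]
    rintro _ ⟨i, rfl⟩
    have h1 := key _ (hcf i) (Pi.single i c) (by simp)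
    have hc0 : algebraMap R p.ResidueField c ≠ 0 := by
      rwa [Ne, Ideal.algebraMap_residueField_eq_zero]
    have h2 : residueVec p (Pi.single i c) =
        algebraMap R p.ResidueField c • (Pi.basisFun p.ResidueField (Fin n) i) := by
      funext l
      by_cases h : l = i
      · subst h; simp [residueVec]
      · simp [residueVec, h]
    rw [h2] at h1
    exact (Submodule.smul_mem_iff _ hc0).mp h1
  have h1 := Submodule.finrank_add_le_finrank_add_finrank Y X
  rw [htop, finrank_top, Module.finrank_fin_fun] at h1
  refine h1.trans ?_
  gcongr
  exact (finrank_span_finset_le_card _).trans Finset.card_image_le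

/-- A minimal generating set of the localized ideal is cleared of denominators to form `U`; the
product of the denominators for the `f i` serves as `c`. -/
theorem le_spanFinrank_add_finrank [IsNoetherianRing R] {m : ℕ} (f : Fin n → R)
    (φ : Matrix (Fin n) (Fin m) R)
    (hex : Function.Exact φ.mulVecLin (Fintype.linearCombination R f)) :
    n ≤ Submodule.spanFinrank ((Ideal.span (Set.range f)).map
        (algebraMap R (Localization.AtPrime p))) +
      Module.finrank p.ResidueField (Submodule.span p.ResidueField
        (Set.range fun j => residueVec p fun i => φ i j)) := by
  classical
  set I := Ideal.span (Set.range f) with hI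
  obtain ⟨t, htc, ht⟩ := Submodule.FG.exists_span_finset_card_eq_spanFinrank
    (IsNoetherian.noetherian (I.map (algebraMap R (Localization.AtPrime p))))
  have h1 : ∀ z ∈ t, ∃ u ∈ I, ∃ s ∈ p.primeCompl, z * algebraMap R (Localization.AtPrime p) s =
      algebraMap R (Localization.AtPrime p) u := by
    intro z hz
    have hz' : z ∈ I.map (algebraMap R (Localization.AtPrime p)) := by
      rw [← ht]; exact Submodule.subset_span hz
    obtain ⟨⟨u, s⟩, hus⟩ := (IsLocalization.mem_map_algebraMap_iff p.primeCompl _).mp hz'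
    exact ⟨u, u.2, s, s.2, hus⟩
  choose! u huI s hs hus using h1
  let U := t.image u
  have h2 : I.map (algebraMap R (Localization.AtPrime p)) ≤
      (Ideal.span (U : Set R)).map (algebraMap R (Localization.AtPrime p)) := by
    rw [← ht]
    refine Submodule.span_le.mpr fun z hz => ?_
    have hz' : algebraMap R (Localization.AtPrime p) (u z) ∈
        (Ideal.span (U : Set R)).map (algebraMap R (Localization.AtPrime p)) :=
      Ideal.mem_map_of_mem _ (Ideal.subset_span (by
        simp only [U, Finset.coe_image]; exact Set.mem_image_of_mem _ hz))
    rw [← hus z hz] at hz'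
    have hunit := IsLocalization.map_units (Localization.AtPrime p) ⟨s z, hs z hz⟩
    exact (Ideal.unit_mul_mem_iff_mem _ hunit).mp (by rwa [mul_comm])
  have h3 : ∀ i, ∃ c ∉ p, c * f i ∈ Ideal.span (U : Set R) := by
    intro i
    have h4 := h2 (Ideal.mem_map_of_mem _ (Ideal.subset_span (Set.mem_range_self i)))
    obtain ⟨⟨w, c⟩, hwc⟩ := (IsLocalization.mem_map_algebraMap_iff p.primeCompl _).mp h4
    rw [← map_mul, IsLocalization.eq_iff_exists p.primeCompl] at hwc
    obtain ⟨e, he⟩ := hwc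
    refine ⟨e * c, (e * c).2, ?_⟩
    have h5 : (e : R) * c * f i = e * w := by rw [← he]; ring
    rw [h5]
    exact Ideal.mul_mem_left _ _ w.2
  choose c hc hcf using h3
  have h6 := le_card_add_finrank_of_smul_mem p f φ hex U (by
    intro w hw
    obtain ⟨z, hz, rfl⟩ := Finset.mem_image.mp hw
    exact huI z hz) (∏ i, c i) (by
      rw [Ideal.IsPrime.prod_mem_iff]; rintro ⟨i, -, hi⟩; exact hc i hi) (by
      intro i
      obtain ⟨e, he⟩ : c i ∣ ∏ i, c i := Finset.dvd_prod_of_mem c (Finset.mem_univ i)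
      rw [he, mul_comm (c i), mul_assoc]
      exact Ideal.mul_mem_left _ _ (hcf i))
  refine h6.trans ?_
  gcongr
  rw [← htc]; exact Finset.card_image_le

/-- Off `V(I)` the single element `f l` generates `I` locally, so `U = {f l}` and `c = f l` work. -/
theorem le_one_add_finrank_of_notMem {m : ℕ} (f : Fin n → R)
    (φ : Matrix (Fin n) (Fin m) R)
    (hex : Function.Exact φ.mulVecLin (Fintype.linearCombination R f)) {l : Fin n} (hl : f l ∉ p) :
    n ≤ 1 + Module.finrank p.ResidueField (Submodule.span p.ResidueField
        (Set.range fun j => residueVec p fun i => φ i j)) := by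
  have h := le_card_add_finrank_of_smul_mem p f φ hex {f l} (by
    intro u hu; rw [Finset.mem_singleton.mp hu]; exact Ideal.subset_span ⟨l, rfl⟩) (f l) hl (by
    intro i; rw [mul_comm]; exact Ideal.mul_mem_left _ _ (Ideal.subset_span (by simp)))
  simpa using h

/-- Omitting columns lowers the rank by at most their number. -/
theorem finrank_range_le_add {K V : Type*} [Field K] [AddCommGroup V] [Module K V]
    [FiniteDimensional K V] {d : ℕ} (v : Fin d → V) (r : ℕ) :
    Module.finrank K (Submodule.span K (Set.range v)) ≤
      Module.finrank K (Submodule.span K (Set.range fun j : {j : Fin d // (j : ℕ) < r} => v j)) +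
        (d - r) := by
  classical
  have h1 : Submodule.span K (Set.range v) ≤
      Submodule.span K (Set.range fun j : {j : Fin d // (j : ℕ) < r} => v j) ⊔
      Submodule.span K (((Finset.univ.filter fun j : Fin d => r ≤ (j : ℕ)).image v : Finset V) :
        Set V) := by
    rw [Submodule.span_le]
    rintro _ ⟨j, rfl⟩
    by_cases h : (j : ℕ) < r
    · exact Submodule.mem_sup_left (Submodule.subset_span ⟨⟨j, h⟩, rfl⟩)
    · exact Submodule.mem_sup_right (Submodule.subset_span (by
        simp only [Finset.coe_image]
        exact Set.mem_image_of_mem v (by simpa using h)))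
  refine (Submodule.finrank_mono h1).trans
    ((Submodule.finrank_add_le_finrank_add_finrank _ _).trans ?_)
  gcongr
  refine (finrank_span_finset_le_card _).trans (Finset.card_image_le.trans ?_)
  have h2 : (Finset.univ.filter fun j : Fin d => r ≤ (j : ℕ)).card ≤ (Finset.Ico r d).card := by
    refine Finset.card_le_card_of_injOn (fun j => (j : ℕ)) ?_ (Fin.val_injective.injOn)
    intro j hj
    simp at hj ⊢
    exact hj
  simpa using h2

end LinearForms

/-! ### Regularity of `g_1, …, g_d` and the torsion of `Sym(I)`. -/

section Regularity

theorem CechVanish.of_linearEquiv {ι : Type*} [LinearOrder ι] {A : Type*} [CommRing A] (x : ι → A)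
    {M N : Type*} [AddCommGroup M] [Module A M] [AddCommGroup N] [Module A N] (e : M ≃ₗ[A] N)
    {n : ℕ} (h : CechVanish x M n) : CechVanish x N n := by
  intro i hi c hc
  obtain ⟨b, rfl⟩ := cechMap_surjective x i (π := e.toLinearMap) e.surjective c
  have hb : cechD x M i b = 0 := by
    rw [cechD_cechMap] at hc
    obtain ⟨z, hz⟩ := exists_smul_of_cechMap_eq_zero x (g := 0) (fun m hm =>
      ⟨0, by rw [smul_zero]; exact (e.map_eq_zero_iff.mp hm).symm⟩) hc
    rw [← hz, zero_smul]
  have hb' := h i hi b hb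
  cases i with
  | zero =>
    have h0 : b = 0 := hb'
    rw [h0, map_zero]; exact zero_mem _
  | succ i =>
    obtain ⟨a, rfl⟩ := hb'
    exact ⟨cechMap x i e.toLinearMap a, cechD_cechMap x _ a⟩

variable {k : Type*} [Field k] {d : ℕ}

theorem gIdeal_zero (φ : Matrix (Fin (d + 1)) (Fin d) (PolyR k d)) : gIdeal φ 0 = ⊥ := by
  simp [gIdeal]

theorem gOf_mem_gIdeal (φ : Matrix (Fin (d + 1)) (Fin d) (PolyR k d)) {r : ℕ} {j : Fin d}
    (hj : (j : ℕ) < r) : gOf φ j ∈ gIdeal φ r := Ideal.subset_span ⟨j, hj, rfl⟩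

theorem gIdeal_mono (φ : Matrix (Fin (d + 1)) (Fin d) (PolyR k d)) {r r' : ℕ} (h : r ≤ r') :
    gIdeal φ r ≤ gIdeal φ r' :=
  Ideal.span_mono (Set.image_mono fun _ hj => lt_of_lt_of_le hj h)

theorem gIdeal_succ (φ : Matrix (Fin (d + 1)) (Fin d) (PolyR k d)) {r : ℕ} (hr : r < d) :
    gIdeal φ (r + 1) = gIdeal φ r ⊔ Ideal.span {gOf φ ⟨r, hr⟩} := by
  rw [gIdeal, gIdeal, ← Ideal.span_union, ← Set.image_singleton, ← Set.image_union]
  congr 2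
  ext j
  simp only [Set.mem_ofPred_eq, Set.mem_union, Set.mem_singleton_iff, Fin.ext_iff]
  omega

/-- The projection `S/(g_1, …, g_r) → S/(g_1, …, g_{r+1})`. -/
def gProj (φ : Matrix (Fin (d + 1)) (Fin d) (PolyR k d)) (r : ℕ) :
    (PolyS k d ⧸ gIdeal φ r) →ₗ[PolyS k d] (PolyS k d ⧸ gIdeal φ (r + 1)) :=
  (Ideal.Quotient.factorₐ (PolyS k d) (gIdeal_mono φ (Nat.le_succ r))).toLinearMap

theorem gProj_mk (φ : Matrix (Fin (d + 1)) (Fin d) (PolyR k d)) (r : ℕ) (s : PolyS k d) :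
    gProj φ r (Ideal.Quotient.mk _ s) = Ideal.Quotient.mk _ s := rfl

theorem gProj_surjective (φ : Matrix (Fin (d + 1)) (Fin d) (PolyR k d)) (r : ℕ) :
    Function.Surjective (gProj φ r) := by
  intro c
  obtain ⟨s, rfl⟩ := Ideal.Quotient.mk_surjective c
  exact ⟨Ideal.Quotient.mk _ s, rfl⟩

theorem gProj_eq_zero_iff (φ : Matrix (Fin (d + 1)) (Fin d) (PolyR k d)) {r : ℕ} (hr : r < d)
    (m : PolyS k d ⧸ gIdeal φ r) : gProj φ r m = 0 ↔ ∃ m', gOf φ ⟨r, hr⟩ • m' = m := by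
  obtain ⟨s, rfl⟩ := Ideal.Quotient.mk_surjective m
  rw [gProj_mk, Ideal.Quotient.eq_zero_iff_mem, gIdeal_succ φ hr]
  constructor
  · intro h
    obtain ⟨a, ha, b, hb, rfl⟩ := Submodule.mem_sup.mp h
    obtain ⟨c, rfl⟩ := Ideal.mem_span_singleton'.mp hb
    refine ⟨Ideal.Quotient.mk _ c, ?_⟩
    rw [map_add, Ideal.Quotient.eq_zero_iff_mem.mpr ha, zero_add, mul_comm]
    rfl
  · rintro ⟨m', hm'⟩
    obtain ⟨c, rfl⟩ := Ideal.Quotient.mk_surjective m'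
    have h1 : Ideal.Quotient.mk (gIdeal φ r) (gOf φ ⟨r, hr⟩ * c) = Ideal.Quotient.mk _ s := hm'
    have h2 := Ideal.Quotient.eq.mp h1
    have h3 : s = -(gOf φ ⟨r, hr⟩ * c - s) + c * gOf φ ⟨r, hr⟩ := by ring
    rw [h3]
    exact add_mem (Ideal.mem_sup_left (neg_mem h2))
      (Ideal.mem_sup_right (Ideal.mem_span_singleton'.mpr ⟨c, rfl⟩))

/-- Each regular `g_j` costs one degree. The family `x` is arbitrary because two families are
needed: the variables `x_j`, and a long regular sequence in a maximal ideal. -/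
theorem cechVanish_quotient_gIdeal {ι : Type*} [LinearOrder ι] (x : ι → PolyS k d)
    (φ : Matrix (Fin (d + 1)) (Fin d) (PolyR k d)) {r : ℕ} (hr : r ≤ d)
    (hreg : ∀ (j : ℕ) (hj : j < r),
      IsSMulRegular (PolyS k d ⧸ gIdeal φ j) (gOf φ ⟨j, hj.trans_le hr⟩)) {n : ℕ}
    (h : CechVanish x (PolyS k d) (n + r)) : CechVanish x (PolyS k d ⧸ gIdeal φ r) n := by
  induction r generalizing n with
  | zero =>
    refine h.of_linearEquiv x (LinearEquiv.symm ?_)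
    rw [gIdeal_zero]
    exact Submodule.quotEquivOfEqBot ⊥ rfl
  | succ r ih =>
    exact CechVanish.quotient x (ih (Nat.le_of_succ_le hr) (fun j hj => hreg j (Nat.lt_succ_of_lt hj))
      (n := n + 1) (by rwa [add_right_comm])) (hreg r (Nat.lt_succ_self r)) (gProj_surjective φ r)
      (gProj_eq_zero_iff φ hr)

theorem height_polyS_le (Q : Ideal (PolyS k d)) [Q.IsPrime] :
    Q.height ≤ ((d + (d + 1) : ℕ) : ℕ∞) := by
  have h1 := Ideal.height_le_ringKrullDim_of_isPrime (I := Q)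
  rw [MvPolynomial.ringKrullDim_of_isNoetherianRing, MvPolynomial.ringKrullDim_of_isNoetherianRing,
    ringKrullDim_eq_zero_of_field, zero_add] at h1
  simp only [Nat.card_eq_fintype_card, Fintype.card_fin] at h1
  exact_mod_cast h1

/-- Unmixedness: a maximal ideal `𝔫` above `Q` contains a regular sequence of length `2d + 1`, so
`ht Q + (2d + 1 - r) ≤ ht 𝔫 ≤ 2d + 1`. -/
theorem height_le_of_mem_associatedPrimes (φ : Matrix (Fin (d + 1)) (Fin d) (PolyR k d)) {r : ℕ}
    (hr : r ≤ d) (hreg : ∀ (j : ℕ) (hj : j < r),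
      IsSMulRegular (PolyS k d ⧸ gIdeal φ j) (gOf φ ⟨j, hj.trans_le hr⟩))
    {Q : Ideal (PolyS k d)} (hQ : Q ∈ associatedPrimes (PolyS k d) (PolyS k d ⧸ gIdeal φ r)) :
    Q.height ≤ (r : ℕ∞) := by
  have := hQ.1
  obtain ⟨𝔫, h𝔫, hle⟩ := Q.exists_le_maximal hQ.1.ne_top
  obtain ⟨rs, hl, hrs, hmem⟩ := maximalIdealsHaveRegularSequence_polyS k d 𝔫 h𝔫
  have h1 := cechVanish_of_isWeaklyRegular (fun i : Fin rs.length => rs.get i) rs hrs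
    (fun r hr => List.mem_iff_get.mp hr)
  have hl' : rs.length = d + (d + 1) - r + r := by omega
  replace h1 : CechVanish (fun i : Fin rs.length => rs.get i) (PolyS k d) (d + (d + 1) - r + r) :=
    fun i hi => h1 i (hl'.symm ▸ hi)
  have h2 := height_add_le_of_cechVanish _ (𝔫 := 𝔫) (fun i => hmem _ (rs.get_mem i)) _
    (cechVanish_quotient_gIdeal _ φ hr hreg h1) Q hQ hle
  have h3 := h2.trans (height_polyS_le 𝔫)
  have hfin : Q.height ≠ ⊤ := fun h => by simp [h] at h3
  obtain ⟨q, hq⟩ := ENat.ne_top_iff_exists.mp hfin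
  rw [← hq] at h3 ⊢
  norm_cast at h3 ⊢
  omega

theorem le_height_maxIdealR [(maxIdealR k d).IsPrime] : (d : ℕ∞) ≤ (maxIdealR k d).height := by
  obtain ⟨rs, hl, hrs, hmem⟩ := exists_isWeaklyRegular_X k d
  have h1 := cechVanish_of_isWeaklyRegular (MvPolynomial.X : Fin d → PolyR k d) rs hrs hmem
  rw [hl] at h1
  obtain ⟨P, hP⟩ := associatedPrimes.nonempty (PolyR k d) (PolyR k d)
  have hP0 : P ≤ maxIdealR k d := by
    obtain ⟨hPp, y, hy⟩ := isAssociatedPrime_iff.mp hP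
    have hy0 : y ≠ 0 := fun h => hPp.ne_top (by simp [hy, h])
    intro a ha
    rw [hy, Submodule.mem_colon_singleton, Submodule.mem_bot, smul_eq_mul] at ha
    rw [(mul_eq_zero.mp ha).resolve_right hy0]
    exact zero_mem _
  exact le_add_self.trans (height_add_le_of_cechVanish _ (𝔫 := maxIdealR k d)
    (fun j => Ideal.subset_span ⟨j, rfl⟩) d h1 P hP hP0)

variable {f : Fin (d + 1) → PolyR k d} {φ : Matrix (Fin (d + 1)) (Fin d) (PolyR k d)}
  {νs : Fin d → ℕ}

/-- This is where `G_d` enters: it bounds the number of generators in `le_spanFinrank_add_finrank`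
by `ht p`. -/
theorem le_finrank_add_height (hφ : IsHilbertBurch f φ νs) (hG : SatisfiesG (idealI f))
    (p : Ideal (PolyR k d)) [p.IsPrime] (hp : p ≠ maxIdealR k d) (hI : idealI f ≤ p) :
    ((d + 1 : ℕ) : ℕ∞) ≤ p.height + (Module.finrank p.ResidueField (Submodule.span p.ResidueField
      (Set.range fun j => residueVec p fun i => φ i j)) : ℕ) := by
  have h1 := hG p hI hp
  rw [IsLocalization.AtPrime.ringKrullDim_eq_height p] at h1
  have h2 := le_spanFinrank_add_finrank p f φ hφ.exact
  have h1' : (Submodule.spanFinrank ((idealI f).map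
      (algebraMap (PolyR k d) (Localization.AtPrime p))) : ℕ∞) ≤ p.height := by exact_mod_cast h1
  calc ((d + 1 : ℕ) : ℕ∞) ≤ _ := Nat.cast_le.mpr h2
    _ = _ := Nat.cast_add _ _
    _ ≤ _ := by gcongr

/-- Three cases for the contraction `p`. At `𝔪` the height of `p` suffices. On the rest of `V(I)`
one has `ht p + rank φ(p) ≥ d + 1`, and off `V(I)` the rank is at least `d`. Keeping only `r`
columns loses at most `d - r`. -/
theorem le_height_of_gOf_mem (hφ : IsHilbertBurch f φ νs) (hG : SatisfiesG (idealI f)) {r : ℕ}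
    (hr : r ≤ d) (Q : Ideal (PolyS k d)) [Q.IsPrime] (hQ : ∀ j : Fin d, (j : ℕ) < r → gOf φ j ∈ Q) :
    (r : ℕ∞) ≤ Q.height := by
  set p : Ideal (PolyR k d) := Q.comap MvPolynomial.C with hp
  have hpp : p.IsPrime := Ideal.comap_isPrime _ _
  have h1 := height_add_finrank_le p Q hp.symm
    (fun (j : {j : Fin d // (j : ℕ) < r}) i => φ i j) (fun j => hQ j j.2)
  have h2 := finrank_range_le_add (K := p.ResidueField)
    (fun j : Fin d => residueVec p fun i => φ i j) r
  by_cases hm : p = maxIdealR k d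
  · have : (maxIdealR k d).IsPrime := hm ▸ hpp
    have h3 := le_height_maxIdealR (k := k) (d := d)
    calc (r : ℕ∞) ≤ d := by exact_mod_cast hr
      _ ≤ p.height := by rw [hm]; exact h3
      _ ≤ _ := le_self_add.trans h1
  · refine le_trans ?_ h1
    by_cases hI : idealI f ≤ p
    · have h3 := le_finrank_add_height hφ hG p hm hI
      by_cases hfin : p.height = ⊤
      · simp [hfin]
      obtain ⟨q, hq⟩ := ENat.ne_top_iff_exists.mp hfin
      rw [← hq] at h3 ⊢
      norm_cast at h3 ⊢
      omega
    · obtain ⟨l, hl⟩ : ∃ l, f l ∉ p := by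
        by_contra! hcon
        exact hI (Ideal.span_le.mpr (by rintro _ ⟨i, rfl⟩; exact hcon i))
      have h3 := le_one_add_finrank_of_notMem p f φ hφ.exact hl
      refine le_trans ?_ le_add_self
      norm_cast
      omega

/-- A zero divisor would lie in an associated prime, which has height at most `r` yet contains `r +
1` of the forms. -/
theorem isSMulRegular_gOf (hφ : IsHilbertBurch f φ νs) (hG : SatisfiesG (idealI f)) (r : ℕ)
    (hr : r < d) : IsSMulRegular (PolyS k d ⧸ gIdeal φ r) (gOf φ ⟨r, hr⟩) := by
  induction r using Nat.strong_induction_on with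
  | _ r ih =>
    rw [isSMulRegular_iff_right_eq_zero_of_smul]
    by_contra! hcon
    obtain ⟨m, hm, hm0⟩ := hcon
    have h1 : gOf φ ⟨r, hr⟩ ∈ ⋃ p ∈ associatedPrimes (PolyS k d) (PolyS k d ⧸ gIdeal φ r),
        (p : Set (PolyS k d)) := by
      rw [biUnion_associatedPrimes_eq_zero_divisors]; exact ⟨m, hm0, hm⟩
    simp only [Set.mem_iUnion, SetLike.mem_coe] at h1
    obtain ⟨Q, hQ, hgQ⟩ := h1
    have := hQ.1
    have h2 := height_le_of_mem_associatedPrimes φ hr.le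
      (fun j hj => ih j hj (hj.trans hr)) hQ
    have h3 : gIdeal φ r ≤ Q := by
      have h4 := IsAssociatedPrime.annihilator_le hQ
      rwa [Submodule.annihilator_top, Ideal.annihilator_quotient] at h4
    have h5 := le_height_of_gOf_mem hφ hG (r := r + 1) hr Q (by
      intro j hj
      rcases Nat.lt_succ_iff_lt_or_eq.mp hj with hj | hj
      · exact h3 (gOf_mem_gIdeal φ hj)
      · have : j = ⟨r, hr⟩ := Fin.ext hj
        rwa [this])
    have h6 := h5.trans h2
    norm_cast at h6
    omega

/-! #### The torsion of the symmetric algebra -/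

theorem linearForm_mem_gIdeal (hφ : IsHilbertBurch f φ νs) {c : Fin (d + 1) → PolyR k d}
    (hc : Fintype.linearCombination (PolyR k d) f c = 0) : linearForm c ∈ gIdeal φ d := by
  obtain ⟨b, rfl⟩ := (hφ.exact c).mp hc
  have h2 : linearForm (φ.mulVecLin b) = ∑ j, MvPolynomial.C (b j) * gOf φ j := by
    simp only [linearForm, gOf, Matrix.mulVecLin_apply, Matrix.mulVec, dotProduct, map_sum, map_mul,
      Finset.sum_mul, Finset.mul_sum]
    rw [Finset.sum_comm]
    exact Finset.sum_congr rfl fun j _ => Finset.sum_congr rfl fun i _ => by ring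
  rw [h2]
  exact sum_mem fun j _ => Ideal.mul_mem_left _ _ (gOf_mem_gIdeal φ j.2)

theorem koszul_mem_gIdeal (hφ : IsHilbertBurch f φ νs) (i l : Fin (d + 1)) :
    MvPolynomial.C (f i) * MvPolynomial.X l - MvPolynomial.C (f l) * MvPolynomial.X i ∈
      gIdeal φ d := by
  have h1 : MvPolynomial.C (f i) * MvPolynomial.X l - MvPolynomial.C (f l) * MvPolynomial.X i =
      linearForm (Pi.single l (f i) - Pi.single i (f l)) := by
    simp only [linearForm, Pi.sub_apply, map_sub, sub_mul, Finset.sum_sub_distrib]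
    congr 1 <;>
    · rw [Finset.sum_eq_single_of_mem _ (Finset.mem_univ _) (fun j _ hj => by
        rw [Pi.single_eq_of_ne hj, map_zero, zero_mul]), Pi.single_eq_same]
  rw [h1]
  exact linearForm_mem_gIdeal hφ (by rw [map_sub]; simp [mul_comm])

/-- The map `S → R[t]`, `T_i ↦ f_i t`, whose image is the Rees algebra. -/
def reesEval (f : Fin (d + 1) → PolyR k d) : PolyS k d →ₐ[PolyR k d] Polynomial (PolyR k d) :=
  MvPolynomial.aeval fun i => Polynomial.C (f i) * Polynomial.X

/-- Once `f_i` is inverted, the Koszul relations give `T_l = f_l (T_i / f_i)`. So the map from `S`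
factors through `R[t]` by `t ↦ T_i / f_i` and kills `s`. -/
theorem exists_pow_mul_eq_zero_of_reesEval {B : Type*} [CommRing B] (q : PolyS k d →+* B)
    {i : Fin (d + 1)} (hq : ∀ l, q (MvPolynomial.C (f i) * MvPolynomial.X l -
      MvPolynomial.C (f l) * MvPolynomial.X i) = 0) {s : PolyS k d} (hs : reesEval f s = 0) :
    ∃ N : ℕ, q (MvPolynomial.C (f i)) ^ N * q s = 0 := by
  let F : B := q (MvPolynomial.C (f i))
  let L := Localization.Away F
  let θ : PolyS k d →+* L := (algebraMap B L).comp q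
  let u : L := IsLocalization.Away.invSelf F
  have hu : algebraMap B L F * u = 1 := IsLocalization.Away.mul_invSelf F
  let γ : Polynomial (PolyR k d) →+* L :=
    Polynomial.eval₂RingHom (θ.comp MvPolynomial.C) (θ (MvPolynomial.X i) * u)
  have hγ : γ.comp (reesEval f).toRingHom = θ := by
    refine MvPolynomial.ringHom_ext (fun a => ?_) fun l => ?_
    · change γ (reesEval f (MvPolynomial.C a)) = _
      rw [reesEval, MvPolynomial.aeval_C]
      simp [γ]
    · change γ (reesEval f (MvPolynomial.X l)) = _
      rw [reesEval, MvPolynomial.aeval_X]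
      simp only [γ, map_mul, Polynomial.coe_eval₂RingHom, Polynomial.eval₂_C, Polynomial.eval₂_X,
        RingHom.comp_apply]
      have h1 : θ (MvPolynomial.C (f l)) * θ (MvPolynomial.X i) =
          algebraMap B L F * θ (MvPolynomial.X l) := by
        have h2 : θ (MvPolynomial.C (f i) * MvPolynomial.X l -
            MvPolynomial.C (f l) * MvPolynomial.X i) = 0 := by
          rw [RingHom.comp_apply, hq, map_zero]
        rw [map_sub, map_mul, map_mul, sub_eq_zero] at h2
        exact h2.symm
      linear_combination u * h1 + θ (MvPolynomial.X l) * hu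
  have h1 : θ s = 0 := by
    rw [← hγ]
    change γ (reesEval f s) = 0
    rw [hs, map_zero]
  obtain ⟨⟨_, N, rfl⟩, hN⟩ := (IsLocalization.map_eq_zero_iff (Submonoid.powers F) L _).mp h1
  exact ⟨N, hN⟩

theorem exists_pow_mul_mem_gIdeal_of_reesEval (hφ : IsHilbertBurch f φ νs) {s : PolyS k d}
    (hs : reesEval f s = 0) (i : Fin (d + 1)) :
    ∃ N : ℕ, MvPolynomial.C (f i) ^ N * s ∈ gIdeal φ d := by
  obtain ⟨N, hN⟩ := exists_pow_mul_eq_zero_of_reesEval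
    (B := PolyS k d ⧸ gIdeal φ d) (Ideal.Quotient.mk (gIdeal φ d)) (i := i)
    (fun l => Ideal.Quotient.eq_zero_iff_mem.mpr (koszul_mem_gIdeal hφ i l)) hs
  exact ⟨N, by rwa [← Ideal.Quotient.eq_zero_iff_mem, map_mul, map_pow]⟩

/-- Away from `𝔪` the ideal is of linear type. -/
theorem exists_pow_mul_mem_gIdeal (hφ : IsHilbertBurch f φ νs) (hG : SatisfiesG (idealI f))
    {s : PolyS k d} (hs : reesEval f s = 0) (j : Fin d) :
    ∃ N : ℕ, xS k d j ^ N * s ∈ gIdeal φ d := by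
  by_contra! hcon
  -- Once the chain of colon ideals stabilizes at `n`, the element `x_j` is regular on the cyclic
  -- module generated by `x_j ^ n * s`. An associated prime `Q` of that module then avoids `x_j`, so
  -- it does not lie over `𝔪`.
  let a : ℕ →o Ideal (PolyS k d) :=
    { toFun := fun n => (gIdeal φ d).colon {xS k d j ^ n * s}
      monotone' := monotone_nat_of_le_succ fun n => by
        intro b hb
        rw [Submodule.mem_colon_singleton, smul_eq_mul] at hb ⊢
        have : b * (xS k d j ^ (n + 1) * s) = xS k d j * (b * (xS k d j ^ n * s)) := by ring
        rw [this]
        exact Ideal.mul_mem_left _ _ hb }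
  obtain ⟨n, hn⟩ := monotone_stabilizes_iff_noetherian.mpr
    (inferInstanceAs (IsNoetherianRing (PolyS k d))) a
  let c : PolyS k d ⧸ gIdeal φ d := Ideal.Quotient.mk _ (xS k d j ^ n * s)
  have hc : c ≠ 0 := fun h => hcon n (Ideal.Quotient.eq_zero_iff_mem.mp h)
  let L := Submodule.span (PolyS k d) {c}
  have : Nontrivial L := ⟨⟨⟨c, Submodule.mem_span_singleton_self c⟩, 0, fun h =>
    hc (congrArg Subtype.val h)⟩⟩
  obtain ⟨Q, hQ⟩ := associatedPrimes.nonempty (PolyS k d) L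
  obtain ⟨hQp, ⟨y, hyL⟩, hy⟩ := isAssociatedPrime_iff.mp hQ
  obtain ⟨b, rfl⟩ := Submodule.mem_span_singleton.mp hyL
  have hQmem : ∀ e, e ∈ Q ↔ e * b * (xS k d j ^ n * s) ∈ gIdeal φ d := by
    intro e
    rw [hy, Submodule.mem_colon_singleton, Submodule.mem_bot, ← Ideal.Quotient.eq_zero_iff_mem,
      ← Subtype.val_inj]
    change e • b • c = 0 ↔ _
    rw [smul_smul]
    rfl
  have hb : b * (xS k d j ^ n * s) ∉ gIdeal φ d := by
    intro h
    exact hQp.ne_top ((Ideal.eq_top_iff_one _).mpr ((hQmem 1).mpr (by rwa [one_mul])))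
  have hxQ : xS k d j ∉ Q := by
    intro h
    rw [hQmem] at h
    have h1 : b ∈ a (n + 1) := by
      change b ∈ (gIdeal φ d).colon {xS k d j ^ (n + 1) * s}
      rw [Submodule.mem_colon_singleton, smul_eq_mul]
      have : b * (xS k d j ^ (n + 1) * s) = xS k d j * b * (xS k d j ^ n * s) := by ring
      rwa [this]
    rw [← hn (n + 1) (Nat.le_succ n)] at h1
    change b ∈ (gIdeal φ d).colon {xS k d j ^ n * s} at h1
    rw [Submodule.mem_colon_singleton, smul_eq_mul] at h1
    exact hb h1
  have hQ' : Q ∈ associatedPrimes (PolyS k d) (PolyS k d ⧸ gIdeal φ d) :=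
    IsAssociatedPrime.map_of_injective L.subtype hQ L.injective_subtype
  have hht := height_le_of_mem_associatedPrimes φ le_rfl (fun j hj => isSMulRegular_gOf hφ hG j hj)
    hQ'
  set p : Ideal (PolyR k d) := Q.comap MvPolynomial.C with hp
  have hpp : p.IsPrime := Ideal.comap_isPrime _ _
  have hpm : p ≠ maxIdealR k d := by
    intro h
    have : MvPolynomial.X j ∈ p := by rw [h]; exact Ideal.subset_span ⟨j, rfl⟩
    exact hxQ this
  by_cases hI : idealI f ≤ p
  · have h3 : gIdeal φ d ≤ Q := by
      have h4 := IsAssociatedPrime.annihilator_le hQ'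
      rwa [Submodule.annihilator_top, Ideal.annihilator_quotient] at h4
    have h1 := height_add_finrank_le p Q hp.symm (fun (j : Fin d) i => φ i j)
      (fun j => h3 (gOf_mem_gIdeal φ j.2))
    -- On `V(I)` away from `𝔪` this reads `d + 1 ≤ ht Q ≤ d`.
    have h5 := ((le_finrank_add_height hφ hG p hpm hI).trans h1).trans hht
    norm_cast at h5
    omega
  · obtain ⟨l, hl⟩ : ∃ l, f l ∉ p := by
      by_contra! hcon
      exact hI (Ideal.span_le.mpr (by rintro _ ⟨i, rfl⟩; exact hcon i))
    obtain ⟨N, hN⟩ := exists_pow_mul_mem_gIdeal_of_reesEval hφ hs l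
    -- Off `V(I)` a power of `f l` kills `s` modulo the `g_j`, so `f l ∈ Q`, contrary to the choice
    -- of `l`.
    refine hl (hQp.mem_of_pow_mem N ((hQmem _).mpr ?_))
    have : MvPolynomial.C (f l) ^ N * b * (xS k d j ^ n * s) =
        b * xS k d j ^ n * (MvPolynomial.C (f l) ^ N * s) := by ring
    rw [this]
    exact Ideal.mul_mem_left _ _ hN

end Regularity

/-! ### Projections onto bigraded components, on modules and on Čech cochains. -/

section Projections

variable {k : Type*} [Field k] {d : ℕ}

/-- The component of degree `q` of a polynomial in `R`, for `q : ℤ`. -/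
def degProj (q : ℤ) (a : PolyR k d) : PolyR k d :=
  ∑ u ∈ a.support, if (u.degree : ℤ) = q then MvPolynomial.monomial u (a.coeff u) else 0

theorem coeff_degProj (q : ℤ) (a : PolyR k d) (u : Fin d →₀ ℕ) :
    (degProj q a).coeff u = if (u.degree : ℤ) = q then a.coeff u else 0 := by
  classical
  rw [degProj, MvPolynomial.coeff_sum]
  have h : ∀ v ∈ a.support, MvPolynomial.coeff u (if (v.degree : ℤ) = q then
      MvPolynomial.monomial v (a.coeff v) else 0) =
      if v = u then (if (u.degree : ℤ) = q then a.coeff u else 0) else 0 := by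
    intro v _
    by_cases hvu : v = u
    · subst hvu
      by_cases hq : (v.degree : ℤ) = q <;> simp [hq]
    · by_cases hq : (v.degree : ℤ) = q <;> simp [hq, hvu, MvPolynomial.coeff_monomial]
  rw [Finset.sum_congr rfl h, Finset.sum_ite_eq']
  by_cases hu : u ∈ a.support
  · rw [if_pos hu]
  · rw [if_neg hu, MvPolynomial.notMem_support_iff.mp hu, ite_self]

/-- The projection `S → S_{p,q}`, as a function. -/
def gradeProjFun (p q : ℤ) (s : PolyS k d) : PolyS k d :=
  ∑ e ∈ s.support, if (e.degree : ℤ) = p then MvPolynomial.monomial e (degProj q (s.coeff e)) else 0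

theorem coeff_gradeProjFun (p q : ℤ) (s : PolyS k d) (e : Fin (d + 1) →₀ ℕ) (u : Fin d →₀ ℕ) :
    MvPolynomial.coeff u (MvPolynomial.coeff e (gradeProjFun p q s)) =
      if (e.degree : ℤ) = p ∧ (u.degree : ℤ) = q then
        MvPolynomial.coeff u (MvPolynomial.coeff e s) else 0 := by
  classical
  rw [gradeProjFun, MvPolynomial.coeff_sum]
  have h : ∀ v ∈ s.support, MvPolynomial.coeff e (if (v.degree : ℤ) = p then
      MvPolynomial.monomial v (degProj q (s.coeff v)) else 0) =
      if v = e then (if (e.degree : ℤ) = p then degProj q (s.coeff e) else 0) else 0 := by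
    intro v _
    by_cases hve : v = e
    · subst hve
      by_cases hq : (v.degree : ℤ) = p <;> simp [hq]
    · by_cases hq : (v.degree : ℤ) = p <;> simp [hq, hve, MvPolynomial.coeff_monomial]
  rw [Finset.sum_congr rfl h, Finset.sum_ite_eq']
  by_cases he : e ∈ s.support
  · rw [if_pos he]
    by_cases hp : (e.degree : ℤ) = p
    · rw [if_pos hp, coeff_degProj]; simp [hp]
    · simp [hp]
  · rw [if_neg he, MvPolynomial.notMem_support_iff.mp he]; simp

theorem polyS_ext {s t : PolyS k d} (h : ∀ e u, MvPolynomial.coeff u (MvPolynomial.coeff e s) =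
    MvPolynomial.coeff u (MvPolynomial.coeff e t)) : s = t :=
  MvPolynomial.ext _ _ fun e => MvPolynomial.ext _ _ fun u => h e u

/-- The projection `S → S_{p,q}`. -/
def gradeProj (p q : ℤ) : PolyS k d →+ PolyS k d where
  toFun := gradeProjFun p q
  map_zero' := polyS_ext fun e u => by rw [coeff_gradeProjFun]; simp
  map_add' s t := polyS_ext fun e u => by
    rw [MvPolynomial.coeff_add, MvPolynomial.coeff_add, coeff_gradeProjFun, coeff_gradeProjFun,
      coeff_gradeProjFun, MvPolynomial.coeff_add, MvPolynomial.coeff_add]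
    split_ifs <;> simp

theorem coeff_gradeProj (p q : ℤ) (s : PolyS k d) (e : Fin (d + 1) →₀ ℕ) (u : Fin d →₀ ℕ) :
    MvPolynomial.coeff u (MvPolynomial.coeff e (gradeProj p q s)) =
      if (e.degree : ℤ) = p ∧ (u.degree : ℤ) = q then
        MvPolynomial.coeff u (MvPolynomial.coeff e s) else 0 := coeff_gradeProjFun p q s e u

theorem gradeProj_mem (p q : ℤ) (s : PolyS k d) : gradeProj p q s ∈ gradeS k d p q := by
  intro e u h
  rw [coeff_gradeProj] at h
  by_contra hcon
  rw [if_neg hcon] at h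
  exact h rfl

theorem gradeProj_of_mem {p q : ℤ} {s : PolyS k d} (hs : s ∈ gradeS k d p q) :
    gradeProj p q s = s := polyS_ext fun e u => by
  rw [coeff_gradeProj]
  split_ifs with h
  · rfl
  · by_contra h0; exact h (hs e u (Ne.symm h0))

theorem gradeProj_of_mem_of_ne {p q p' q' : ℤ} {s : PolyS k d} (hs : s ∈ gradeS k d p' q')
    (hne : ¬ (p' = p ∧ q' = q)) : gradeProj p q s = 0 := polyS_ext fun e u => by
  rw [coeff_gradeProj]
  split_ifs with h
  · by_contra h0
    obtain ⟨h1, h2⟩ := hs e u (fun h => h0 (by simp [h]))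
    exact hne ⟨h1.symm.trans h.1, h2.symm.trans h.2⟩
  · simp

theorem monomial_mem_gradeS (e : Fin (d + 1) →₀ ℕ) (u : Fin d →₀ ℕ) (c : k) :
    (MvPolynomial.monomial e (MvPolynomial.monomial u c) : PolyS k d) ∈
      gradeS k d e.degree u.degree := by
  classical
  intro e' u' h
  rw [MvPolynomial.coeff_monomial] at h
  split_ifs at h with he
  · rw [MvPolynomial.coeff_monomial] at h
    split_ifs at h with hu
    · exact ⟨by rw [he], by rw [hu]⟩
    · exact absurd rfl h
  · simp at h

theorem mul_mem_gradeS {p q p' q' : ℤ} {s t : PolyS k d} (hs : s ∈ gradeS k d p q)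
    (ht : t ∈ gradeS k d p' q') : s * t ∈ gradeS k d (p + p') (q + q') := by
  classical
  intro e u h
  rw [MvPolynomial.coeff_mul, MvPolynomial.coeff_sum] at h
  obtain ⟨⟨e₁, e₂⟩, he, h⟩ := Finset.exists_ne_zero_of_sum_ne_zero h
  rw [MvPolynomial.coeff_mul] at h
  obtain ⟨⟨u₁, u₂⟩, hu, h⟩ := Finset.exists_ne_zero_of_sum_ne_zero h
  obtain ⟨h1, h2⟩ := hs e₁ u₁ (left_ne_zero_of_mul h)
  obtain ⟨h3, h4⟩ := ht e₂ u₂ (right_ne_zero_of_mul h)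
  rw [← Finset.HasAntidiagonal.mem_antidiagonal.mp he,
    ← Finset.HasAntidiagonal.mem_antidiagonal.mp hu, map_add, map_add]
  push_cast
  exact ⟨by rw [h1, h3], by rw [h2, h4]⟩

theorem gradeProj_mul {a b : ℤ} {s : PolyS k d} (hs : s ∈ gradeS k d a b) (p q : ℤ)
    (t : PolyS k d) : gradeProj (p + a) (q + b) (s * t) = s * gradeProj p q t := by
  induction t using MvPolynomial.induction_on' with
  | monomial e r =>
    induction r using MvPolynomial.induction_on' with
    | monomial u c =>
      have h1 := monomial_mem_gradeS (k := k) (d := d) e u c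
      have h2 := mul_mem_gradeS hs h1
      by_cases h : (e.degree : ℤ) = p ∧ (u.degree : ℤ) = q
      · obtain ⟨rfl, rfl⟩ := h
        rw [gradeProj_of_mem h1, gradeProj_of_mem (by rwa [add_comm a, add_comm b] at h2)]
      · rw [gradeProj_of_mem_of_ne h1 h, gradeProj_of_mem_of_ne h2 (by omega), mul_zero]
    | add r r' hr hr' => rw [map_add, mul_add, map_add, map_add, mul_add, hr, hr']
  | add t t' ht ht' => rw [mul_add, map_add, map_add, mul_add, ht, ht']

theorem one_mem_gradeS : (1 : PolyS k d) ∈ gradeS k d 0 0 := by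
  have h := monomial_mem_gradeS (k := k) (d := d) 0 0 1
  simpa using h

theorem xS_mem_gradeS (j : Fin d) : xS k d j ∈ gradeS k d 0 1 := by
  have h := monomial_mem_gradeS (k := k) (d := d) 0 (Finsupp.single j 1) 1
  simpa [xS, MvPolynomial.X] using h

theorem gOf_mem_gradeS {φ : Matrix (Fin (d + 1)) (Fin d) (PolyR k d)} {j : Fin d} {n : ℕ}
    (h : ∀ i, (φ i j).IsHomogeneous n) : gOf φ j ∈ gradeS k d 1 n := by
  classical
  refine sum_mem fun i _ => ?_
  intro e u hne
  rw [MvPolynomial.coeff_C_mul, MvPolynomial.X, MvPolynomial.coeff_monomial] at hne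
  split_ifs at hne with he
  · rw [mul_one] at hne
    refine ⟨by simp [← he], ?_⟩
    have h1 := h i hne
    have h2 : u.degree = n := (DFunLike.congr_fun Finsupp.degree_eq_weight_one u).trans h1
    rw [h2]
  · simp at hne

theorem gradeS_unique {a b a' b' : ℤ} {s : PolyS k d} (hs : s ≠ 0) (h : s ∈ gradeS k d a b)
    (h' : s ∈ gradeS k d a' b') : a = a' ∧ b = b' := by
  by_contra hne
  exact hs (by rw [← gradeProj_of_mem h', gradeProj_of_mem_of_ne h hne])

theorem gradeProj_mem_gIdeal {φ : Matrix (Fin (d + 1)) (Fin d) (PolyR k d)} {νs : Fin d → ℕ}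
    (h : ∀ i j, (φ i j).IsHomogeneous (νs j)) (r : ℕ) {s : PolyS k d} (hs : s ∈ gIdeal φ r)
    (p q : ℤ) : gradeProj p q s ∈ gIdeal φ r := by
  -- The projections are not `S`-linear, so the span induction must carry arbitrary multiples of
  -- `s`.
  suffices h1 : ∀ t, ∀ p q, gradeProj p q (t * s) ∈ gIdeal φ r by simpa using h1 1 p q
  induction hs using Submodule.span_induction with
  | mem s hs =>
    obtain ⟨j, hj, rfl⟩ := hs
    intro t p q
    have h2 := gradeProj_mul (gOf_mem_gradeS fun i => h i j) (p - 1) (q - νs j) t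
    rw [sub_add_cancel, sub_add_cancel] at h2
    rw [mul_comm, h2]
    exact Ideal.mul_mem_right _ _ (gOf_mem_gIdeal φ hj)
  | zero => intro t p q; simp
  | add s s' _ _ hs hs' => intro t p q; rw [mul_add, map_add]; exact add_mem (hs t p q) (hs' t p q)
  | smul a s _ hs => intro t p q; rw [smul_eq_mul, ← mul_assoc]; exact hs _ p q

/-! #### Bigraded modules given by projections -/

/-- A family of projections onto the components of a bigraded `S`-module. -/
structure BigradedProj (k : Type*) [Field k] (d : ℕ) {M : Type*} [AddCommGroup M] [Module (PolyS k d) M]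
    (𝓜 : ℤ → ℤ → AddSubgroup M) where
  /-- The projection onto the component of bidegree `(p, q)`. -/
  proj : ℤ → ℤ → M →+ M
  proj_mem : ∀ p q m, proj p q m ∈ 𝓜 p q
  proj_of_mem : ∀ {p q m}, m ∈ 𝓜 p q → proj p q m = m
  proj_smul : ∀ {a b : ℤ} {s : PolyS k d}, s ∈ gradeS k d a b → ∀ p q m,
    proj (p + a) (q + b) (s • m) = s • proj p q m

/-- The projections of `S/J` for a bihomogeneous ideal `J`. -/
def quotProj (J : Ideal (PolyS k d)) (hJ : ∀ s ∈ J, ∀ p q, gradeProj p q s ∈ J) :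
    BigradedProj k d (gradeQuot J) where
  proj p q := QuotientAddGroup.map (Submodule.toAddSubgroup J) (Submodule.toAddSubgroup J)
    (gradeProj p q) (fun s hs => hJ s hs p q)
  proj_mem p q m := by
    obtain ⟨s, rfl⟩ := Ideal.Quotient.mk_surjective m
    exact ⟨gradeProj p q s, gradeProj_mem p q s, rfl⟩
  proj_of_mem := by
    rintro p q _ ⟨s, hs, rfl⟩
    exact congrArg (Ideal.Quotient.mk J) (gradeProj_of_mem hs)
  proj_smul := by
    intro a b s hs p q m
    obtain ⟨t, rfl⟩ := Ideal.Quotient.mk_surjective m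
    exact congrArg (Ideal.Quotient.mk J) (gradeProj_mul hs p q t)

theorem exists_mem_gradeS_of_mem_cechSubmonoid {σ : Finset (Fin d)} {s : PolyS k d}
    (hs : s ∈ cechSubmonoid (xS k d) σ) : ∃ b : ℤ, s ∈ gradeS k d 0 b := by
  induction hs using Submonoid.closure_induction with
  | mem s hs => obtain ⟨j, -, rfl⟩ := hs; exact ⟨1, xS_mem_gradeS j⟩
  | one => exact ⟨0, one_mem_gradeS⟩
  | mul s t _ _ hs ht =>
    obtain ⟨b, hb⟩ := hs
    obtain ⟨c, hc⟩ := ht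
    exact ⟨b + c, by simpa using mul_mem_gradeS hb hc⟩

theorem xS_ne_zero (j : Fin d) : xS k d j ≠ 0 := by
  rw [xS, Ne, MvPolynomial.C_eq_zero]
  exact MvPolynomial.X_ne_zero j

theorem ne_zero_of_mem_cechSubmonoid {σ : Finset (Fin d)} {s : PolyS k d}
    (hs : s ∈ cechSubmonoid (xS k d) σ) : s ≠ 0 := by
  induction hs using Submonoid.closure_induction with
  | mem s hs => obtain ⟨j, -, rfl⟩ := hs; exact xS_ne_zero j
  | one => exact one_ne_zero
  | mul s t _ _ hs ht => exact mul_ne_zero hs ht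

/-- The degree of a monomial in the variables `x_j`. -/
def cechDeg {σ : Finset (Fin d)} (s : cechSubmonoid (xS k d) σ) : ℤ :=
  (exists_mem_gradeS_of_mem_cechSubmonoid s.2).choose

theorem mem_gradeS_cechDeg {σ : Finset (Fin d)} (s : cechSubmonoid (xS k d) σ) :
    (s : PolyS k d) ∈ gradeS k d 0 (cechDeg s) :=
  (exists_mem_gradeS_of_mem_cechSubmonoid s.2).choose_spec

/-- The chosen degree is forced, as a nonzero element has at most one bidegree; additivity of
`cechDeg` follows. -/
theorem eq_cechDeg {σ : Finset (Fin d)} {s : cechSubmonoid (xS k d) σ} {a b : ℤ}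
    (h : (s : PolyS k d) ∈ gradeS k d a b) : a = 0 ∧ b = cechDeg s :=
  gradeS_unique (ne_zero_of_mem_cechSubmonoid s.2) h (mem_gradeS_cechDeg s)

theorem cechDeg_mul {σ : Finset (Fin d)} (s t : cechSubmonoid (xS k d) σ) :
    cechDeg (s * t) = cechDeg s + cechDeg t :=
  (eq_cechDeg (mul_mem_gradeS (mem_gradeS_cechDeg s) (mem_gradeS_cechDeg t))).2.symm

theorem cechDeg_one {σ : Finset (Fin d)} : cechDeg (1 : cechSubmonoid (xS k d) σ) = 0 :=
  (eq_cechDeg one_mem_gradeS).2.symm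

variable {M : Type*} [AddCommGroup M] [Module (PolyS k d) M] {𝓜 : ℤ → ℤ → AddSubgroup M}
  {N : Type*} [AddCommGroup N] [Module (PolyS k d) N] {𝓝 : ℤ → ℤ → AddSubgroup N}

namespace BigradedProj

theorem proj_cech_smul (P : BigradedProj k d 𝓜) {σ : Finset (Fin d)} (s : cechSubmonoid (xS k d) σ)
    {p q q' : ℤ} (m : M) (h : q' = q + cechDeg s) : P.proj p q' (s • m) = s • P.proj p q m := by
  have h1 := P.proj_smul (mem_gradeS_cechDeg s) p q m
  rw [add_zero] at h1
  rw [h]; exact h1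

/-- The projections of `M_{x_σ}`. -/
def locProj (P : BigradedProj k d 𝓜) (σ : Finset (Fin d)) (p q : ℤ) :
    LocalizedModule (cechSubmonoid (xS k d) σ) M →+
      LocalizedModule (cechSubmonoid (xS k d) σ) M where
  toFun z := z.liftOn
    (fun y : M × cechSubmonoid (xS k d) σ => LocalizedModule.mk (P.proj p (q + cechDeg y.2) y.1) y.2)
    (by
      rintro ⟨m, s⟩ ⟨m', s'⟩ ⟨u, hu⟩
      refine LocalizedModule.mk_eq.mpr ⟨u, ?_⟩
      -- In this degree, pulling out the homogeneous factors leaves the numerators of both fractions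
      -- in their own degrees `q + deg s` and `q + deg s'`.
      have h := congrArg (P.proj p (q + cechDeg s + cechDeg s' + cechDeg u)) hu
      rw [P.proj_cech_smul u (q := q + cechDeg s + cechDeg s') _ rfl,
        P.proj_cech_smul s' (q := q + cechDeg s) _ rfl,
        P.proj_cech_smul u (q := q + cechDeg s + cechDeg s') _ rfl,
        P.proj_cech_smul s (q := q + cechDeg s') _ (by ring)] at h
      exact h)
  map_zero' := by
    rw [← LocalizedModule.zero_mk 1, LocalizedModule.liftOn_mk, map_zero, LocalizedModule.zero_mk]
  map_add' z z' := by
    induction z using LocalizedModule.induction_on with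
    | h m s =>
    induction z' using LocalizedModule.induction_on with
    | h m' s' =>
    rw [LocalizedModule.mk_add_mk, LocalizedModule.liftOn_mk, LocalizedModule.liftOn_mk,
      LocalizedModule.liftOn_mk, LocalizedModule.mk_add_mk, map_add, cechDeg_mul,
      P.proj_cech_smul s' (q := q + cechDeg s) _ (by ring),
      P.proj_cech_smul s (q := q + cechDeg s') _ (by ring)]

theorem locProj_mk (P : BigradedProj k d 𝓜) (σ : Finset (Fin d)) (p q : ℤ) (m : M)
    (s : cechSubmonoid (xS k d) σ) : P.locProj σ p q (LocalizedModule.mk m s) =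
      LocalizedModule.mk (P.proj p (q + cechDeg s) m) s := rfl

theorem locProj_mem (P : BigradedProj k d 𝓜) (σ : Finset (Fin d)) (p q : ℤ)
    (z : LocalizedModule (cechSubmonoid (xS k d) σ) M) : P.locProj σ p q z ∈ gradeLoc M 𝓜 σ p q := by
  induction z using LocalizedModule.induction_on with
  | h m s =>
    rw [locProj_mk]
    exact AddSubgroup.subset_closure ⟨0, cechDeg s, s, _, mem_gradeS_cechDeg s, by
      rw [add_zero]; exact P.proj_mem _ _ _, rfl⟩

theorem locProj_of_mem (P : BigradedProj k d 𝓜) {σ : Finset (Fin d)} {p q : ℤ}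
    {z : LocalizedModule (cechSubmonoid (xS k d) σ) M} (hz : z ∈ gradeLoc M 𝓜 σ p q) :
    P.locProj σ p q z = z := by
  induction hz using AddSubgroup.closure_induction with
  | mem z hz =>
    obtain ⟨a, b, s, m, hs, hm, rfl⟩ := hz
    obtain ⟨rfl, rfl⟩ := eq_cechDeg hs
    rw [add_zero] at hm
    rw [locProj_mk, P.proj_of_mem hm]
  | zero => exact map_zero _
  | add z z' _ _ hz hz' => rw [map_add, hz, hz']
  | neg z _ hz => rw [map_neg, hz]

theorem locProj_smul (P : BigradedProj k d 𝓜) (σ : Finset (Fin d)) {a b : ℤ} {s : PolyS k d}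
    (hs : s ∈ gradeS k d a b) (p q : ℤ) (z : LocalizedModule (cechSubmonoid (xS k d) σ) M) :
    P.locProj σ (p + a) (q + b) (s • z) = s • P.locProj σ p q z := by
  induction z using LocalizedModule.induction_on with
  | h m t =>
    rw [LocalizedModule.smul'_mk, locProj_mk, locProj_mk, LocalizedModule.smul'_mk,
      add_right_comm q, P.proj_smul hs]

theorem cechRes_locProj (P : BigradedProj k d 𝓜) {σ τ : Finset (Fin d)} (h : σ ⊆ τ) (p q : ℤ)
    (z : LocalizedModule (cechSubmonoid (xS k d) σ) M) :
    cechRes (xS k d) M h (P.locProj σ p q z) = P.locProj τ p q (cechRes (xS k d) M h z) := by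
  induction z using LocalizedModule.induction_on with
  | h m s =>
    rw [locProj_mk, cechRes_mk, cechRes_mk, locProj_mk]
    have h1 : cechDeg (⟨s.1, cechSubmonoid_mono (xS k d) h s.2⟩ : cechSubmonoid (xS k d) τ) =
        cechDeg s := (eq_cechDeg (s := ⟨s.1, cechSubmonoid_mono (xS k d) h s.2⟩)
          (mem_gradeS_cechDeg s)).2.symm
    rw [h1]

/-- The projections of the Čech cochains. -/
def cochainProj (P : BigradedProj k d 𝓜) (i : ℕ) (p q : ℤ) (c : CechCochain (xS k d) M i) :
    CechCochain (xS k d) M i := fun σ => P.locProj σ.1 p q (c σ)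

theorem cochainProj_eq_self_iff (P : BigradedProj k d 𝓜) {i : ℕ} {p q : ℤ}
    {c : CechCochain (xS k d) M i} :
    P.cochainProj i p q c = c ↔ ∀ σ, c σ ∈ gradeLoc M 𝓜 σ.1 p q := by
  constructor
  · intro h σ
    rw [← h]; exact P.locProj_mem _ _ _ _
  · intro h
    funext σ
    exact P.locProj_of_mem (h σ)

theorem cochainProj_cochainProj (P : BigradedProj k d 𝓜) {i : ℕ} {p q : ℤ}
    (c : CechCochain (xS k d) M i) :
    P.cochainProj i p q (P.cochainProj i p q c) = P.cochainProj i p q c :=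
  P.cochainProj_eq_self_iff.mpr fun _ => P.locProj_mem _ _ _ _

theorem cochainProj_smul (P : BigradedProj k d 𝓜) (i : ℕ) {a b : ℤ} {s : PolyS k d}
    (hs : s ∈ gradeS k d a b) (p q : ℤ) (c : CechCochain (xS k d) M i) :
    P.cochainProj i (p + a) (q + b) (s • c) = s • P.cochainProj i p q c :=
  funext fun σ => P.locProj_smul σ.1 hs p q (c σ)

theorem cechPush_cochainProj (P : BigradedProj k d 𝓜) {i : ℕ} (p q : ℤ) (c : CechCochain (xS k d) M i)
    (ρ σ : Finset (Fin d)) :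
    cechPush (xS k d) (P.cochainProj i p q c) ρ σ = P.locProj ρ p q (cechPush (xS k d) c ρ σ) := by
  by_cases h : σ.card = i ∧ σ ⊆ ρ
  · rw [cechPush, cechPush, dif_pos h, dif_pos h, ← cechRes_locProj]; rfl
  · rw [cechPush, cechPush, dif_neg h, dif_neg h, map_zero]

theorem cechSign_mem_gradeS (τ : Finset (Fin d)) (j : Fin d) :
    cechSign (PolyS k d) τ j ∈ gradeS k d 0 0 := by
  rcases neg_one_pow_eq_or (PolyS k d) (τ.filter (· < j)).card with h | h
  · rw [cechSign, h]; exact one_mem_gradeS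
  · rw [cechSign, h]; exact neg_mem one_mem_gradeS

theorem cechD_cochainProj (P : BigradedProj k d 𝓜) {i : ℕ} (p q : ℤ) (c : CechCochain (xS k d) M i) :
    cechD (xS k d) M i (P.cochainProj i p q c) =
      P.cochainProj (i + 1) p q (cechD (xS k d) M i c) := by
  funext τ
  rw [cechD_apply]
  change _ = P.locProj τ.1 p q (cechD (xS k d) M i c τ)
  rw [cechD_apply, map_sum]
  refine Finset.sum_congr rfl fun j _ => ?_
  rw [cechPush_cochainProj]
  have h := P.locProj_smul τ.1 (cechSign_mem_gradeS τ.1 j) p q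
    (cechPush (xS k d) c τ.1 (τ.1.erase j))
  rw [add_zero, add_zero] at h
  exact h.symm

theorem cechMap_cochainProj (P : BigradedProj k d 𝓜) (P' : BigradedProj k d 𝓝) {π : M →ₗ[PolyS k d] N}
    (hπ : ∀ p q m, π (P.proj p q m) = P'.proj p q (π m)) {i : ℕ} (p q : ℤ)
    (c : CechCochain (xS k d) M i) :
    cechMap (xS k d) i π (P.cochainProj i p q c) =
      P'.cochainProj i p q (cechMap (xS k d) i π c) := by
  funext σ
  induction h : c σ using LocalizedModule.induction_on with
  | h m s =>
    have h1 : P.cochainProj i p q c σ = LocalizedModule.mk (P.proj p (q + cechDeg s) m) s := by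
      rw [← locProj_mk, ← h]; rfl
    rw [cechMap_apply_of_eq_mk _ π _ σ h1, hπ, ← locProj_mk, ← cechMap_apply_of_eq_mk _ π c σ h]
    rfl

end BigradedProj

end Projections

/-! ### The connecting isomorphism. -/

section Connecting

/-- Two surjections with the same kernel have isomorphic targets. -/
theorem exists_linearEquiv_of_ker_eq {A E X Y : Type*} [CommRing A] [AddCommGroup E] [Module A E]
    [AddCommGroup X] [Module A X] [AddCommGroup Y] [Module A Y] (u : E →ₗ[A] X) (v : E →ₗ[A] Y)
    (hu : Function.Surjective u) (hv : Function.Surjective v)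
    (h : LinearMap.ker u = LinearMap.ker v) : ∃ e : X ≃ₗ[A] Y, ∀ z, e (u z) = v z := by
  refine ⟨(u.quotKerEquivOfSurjective hu).symm ≪≫ₗ Submodule.quotEquivOfEq _ _ h ≪≫ₗ
    v.quotKerEquivOfSurjective hv, fun z => ?_⟩
  have h1 : (u.quotKerEquivOfSurjective hu).symm (u z) = Submodule.Quotient.mk z := by
    rw [LinearEquiv.symm_apply_eq]; rfl
  rw [LinearEquiv.trans_apply, LinearEquiv.trans_apply, h1]
  rfl

theorem cechClass_eq_zero_iff {ι : Type*} [LinearOrder ι] {A : Type*} [CommRing A] (x : ι → A)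
    {M : Type*} [AddCommGroup M] [Module A M] {i : ℕ} (c : cechZ x M i) :
    cechClass x M i c = 0 ↔ (c : CechCochain x M i) ∈ cechB x M i :=
  Submodule.Quotient.mk_eq_zero _

theorem cechClass_surjective {ι : Type*} [LinearOrder ι] {A : Type*} [CommRing A] (x : ι → A)
    {M : Type*} [AddCommGroup M] [Module A M] (i : ℕ) : Function.Surjective (cechClass x M i) :=
  Submodule.mkQ_surjective _

variable {ι : Type*} [LinearOrder ι] {A : Type*} [CommRing A] (x : ι → A)
  {M : Type*} [AddCommGroup M] [Module A M] {N : Type*} [AddCommGroup N] [Module A N]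

theorem cechMap_smul_eq_zero (i : ℕ) {π : M →ₗ[A] N} {g : A} (hg : ∀ m, π (g • m) = 0)
    (c : CechCochain x M i) : cechMap x i π (g • c) = 0 := by
  funext σ
  induction hs : (c σ) using LocalizedModule.induction_on with
  | h m s =>
    rw [cechMap_apply_of_eq_mk x π (g • c) σ (m := g • m) (s := s) (by
      rw [Pi.smul_apply, hs, LocalizedModule.smul'_mk]), hg, LocalizedModule.zero_mk]; rfl

theorem cechMap_mem_cechB {i : ℕ} (π : M →ₗ[A] N) {c : CechCochain x M i} (hc : c ∈ cechB x M i) :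
    cechMap x i π c ∈ cechB x N i := by
  cases i with
  | zero =>
    have h0 : c = 0 := hc
    rw [h0, map_zero]; exact zero_mem _
  | succ i =>
    obtain ⟨a, rfl⟩ := hc
    exact ⟨cechMap x i π a, cechD_cechMap x _ a⟩

/-- The pairs `(c, z)` with `δ c = g z`. -/
def connectingPairs (M : Type*) [AddCommGroup M] [Module A M] (g : A) (i : ℕ) :
    Submodule A (CechCochain x M i × CechCochain x M (i + 1)) :=
  LinearMap.eqLocus (cechD x M i ∘ₗ LinearMap.fst A _ _) (g • LinearMap.snd A _ _)

theorem mem_connectingPairs {g : A} {i : ℕ} {y : CechCochain x M i × CechCochain x M (i + 1)} :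
    y ∈ connectingPairs x M g i ↔ cechD x M i y.1 = g • y.2 := Iff.rfl

/-- For `0 → M → M → N → 0` with first map the multiplication by `g` and `Hⁱ(M) = 0`, the connecting
map identifies `Hⁱ(N)` with the part of `Hⁱ⁺¹(M)` killed by `g`. -/
theorem exists_connecting_equiv {g : A} (hg : IsSMulRegular M g) {π : M →ₗ[A] N}
    (hπ : Function.Surjective π) (hker : ∀ m, π m = 0 ↔ ∃ m', g • m' = m) (i : ℕ)
    (hM : ∀ c : CechCochain x M i, cechD x M i c = 0 → c ∈ cechB x M i) :
    ∃ e : CechH x N i ≃ₗ[A] Submodule.torsionBy A (CechH x M (i + 1)) g,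
      ∀ (c : CechCochain x M i) (z : CechCochain x M (i + 1)) (_ : cechD x M i c = g • z)
        (hz : z ∈ cechZ x M (i + 1)) (hc : cechMap x i π c ∈ cechZ x N i),
        (e (cechClass x N i ⟨cechMap x i π c, hc⟩) : CechH x M (i + 1)) =
          cechClass x M (i + 1) ⟨z, hz⟩ := by
  have hπg : ∀ m, π (g • m) = 0 := fun m => (hker _).mpr ⟨m, rfl⟩
  have hZ : ∀ y ∈ connectingPairs x M g i, cechMap x i π y.1 ∈ cechZ x N i := by
    intro y hy
    rw [LinearMap.mem_ker, cechD_cechMap, (mem_connectingPairs x).mp hy,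
      cechMap_smul_eq_zero x _ hπg]
  have hZ' : ∀ y ∈ connectingPairs x M g i, y.2 ∈ cechZ x M (i + 1) := by
    intro y hy
    rw [LinearMap.mem_ker]
    refine cechCochain_smul_injective x _ hg ?_
    rw [← map_smul, ← (mem_connectingPairs x).mp hy, cechD_cechD, smul_zero]
  -- The connecting map is the correspondence `[π c] ↔ [z]` for `δ c = g z`. Both projections from
  -- pairs to classes are surjective, and it remains to compare their kernels.
  let u : connectingPairs x M g i →ₗ[A] CechH x N i := cechClass x N i ∘ₗ
    (LinearMap.codRestrict (cechZ x N i)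
      (cechMap x i π ∘ₗ LinearMap.fst A _ _ ∘ₗ (connectingPairs x M g i).subtype)
      fun y => hZ y y.2)
  let v₀ : connectingPairs x M g i →ₗ[A] CechH x M (i + 1) := cechClass x M (i + 1) ∘ₗ
    (LinearMap.codRestrict (cechZ x M (i + 1))
      (LinearMap.snd A _ _ ∘ₗ (connectingPairs x M g i).subtype) fun y => hZ' y y.2)
  have hu : ∀ y, u y = 0 ↔ cechMap x i π y.1.1 ∈ cechB x N i := fun y =>
    cechClass_eq_zero_iff x _
  have hv₀ : ∀ y, v₀ y = 0 ↔ y.1.2 ∈ cechB x M (i + 1) := fun y => cechClass_eq_zero_iff x _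
  have hv₀t : ∀ y, v₀ y ∈ Submodule.torsionBy A (CechH x M (i + 1)) g := by
    intro y
    rw [Submodule.mem_torsionBy_iff, ← map_smul, hv₀]
    exact ⟨y.1.1, (mem_connectingPairs x).mp y.2⟩
  let v := LinearMap.codRestrict (Submodule.torsionBy A (CechH x M (i + 1)) g) v₀ hv₀t
  have hus : Function.Surjective u := by
    intro n
    obtain ⟨⟨c', hc'⟩, rfl⟩ := cechClass_surjective x i n
    obtain ⟨c, rfl⟩ := cechMap_surjective x i hπ c'
    have h1 : cechMap x (i + 1) π (cechD x M i c) = 0 := by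
      rw [← cechD_cechMap]; exact hc'
    obtain ⟨z, hz⟩ := exists_smul_of_cechMap_eq_zero x (fun m => (hker m).mp) h1
    exact ⟨⟨(c, z), hz.symm⟩, rfl⟩
  have hvs : Function.Surjective v := by
    rintro ⟨w, hw⟩
    obtain ⟨⟨z, hz⟩, rfl⟩ := cechClass_surjective x (i + 1) w
    rw [Submodule.mem_torsionBy_iff, ← map_smul, cechClass_eq_zero_iff] at hw
    obtain ⟨c, hc⟩ := hw
    exact ⟨⟨(c, z), hc⟩, rfl⟩
  have hk : LinearMap.ker u = LinearMap.ker v := by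
    ext y
    rw [LinearMap.mem_ker, LinearMap.mem_ker, hu, ← Subtype.val_inj]
    change _ ↔ v₀ y = 0
    rw [hv₀]
    obtain ⟨⟨c, z⟩, hy⟩ := y
    have hy' : cechD x M i c = g • z := hy
    change cechMap x i π c ∈ cechB x N i ↔ z ∈ cechB x M (i + 1)
    constructor
    · intro h
      obtain ⟨b, hb, hcb⟩ : ∃ b : CechCochain x M i, cechD x M i b = 0 ∧
          cechMap x i π (c - b) = 0 := by
        cases i with
        | zero =>
          have h0 : cechMap x 0 π c = 0 := h
          exact ⟨0, map_zero _, by rw [sub_zero, h0]⟩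
        | succ i =>
          obtain ⟨a', ha'⟩ := h
          obtain ⟨a, rfl⟩ := cechMap_surjective x i hπ a'
          exact ⟨cechD x M i a, cechD_cechD x a, by rw [map_sub, ← cechD_cechMap, ha', sub_self]⟩
      obtain ⟨e, he⟩ := exists_smul_of_cechMap_eq_zero x (fun m => (hker m).mp) hcb
      refine ⟨e, cechCochain_smul_injective x _ hg ?_⟩
      rw [← map_smul, he, map_sub, hb, sub_zero, hy']
    · rintro ⟨e, he⟩
      have h1 : cechD x M i (c - g • e) = 0 := by
        rw [map_sub, map_smul, he, hy', sub_self]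
      -- Vanishing of `Hⁱ(M)` makes the cocycle `c - g • e` a coboundary; its image under `π` is
      -- that of `c`.
      have h2 := cechMap_mem_cechB x π (hM _ h1)
      rwa [map_sub, cechMap_smul_eq_zero x _ hπg, sub_zero] at h2
  obtain ⟨e, he⟩ := exists_linearEquiv_of_ker_eq u v hus hvs hk
  exact ⟨e, fun c z hcz hz hc => congrArg Subtype.val (he ⟨(c, z), hcz⟩)⟩

end Connecting

/-! ### Bidegrees under the connecting isomorphism. -/

section ConnectingGraded

variable {k : Type*} [Field k] {d : ℕ}
variable {M : Type*} [AddCommGroup M] [Module (PolyS k d) M] {𝓜 : ℤ → ℤ → AddSubgroup M}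
  {N : Type*} [AddCommGroup N] [Module (PolyS k d) N] {𝓝 : ℤ → ℤ → AddSubgroup N}

/-- Homogeneity becomes a fixed-point equation, which passes through `δ`, `π` and multiplication by
`g`. -/
theorem BigradedProj.mem_gradeLocalCoh_iff (P : BigradedProj k d 𝓜) {i : ℕ} {p q : ℤ}
    {w : LocalCoh k d M i} : w ∈ gradeLocalCoh M 𝓜 i p q ↔
      ∃ c : cechZ (xS k d) M i, P.cochainProj i p q c = c ∧ cechClass (xS k d) M i c = w := by
  constructor
  · rintro ⟨c, hc, rfl⟩
    exact ⟨c, P.cochainProj_eq_self_iff.mpr fun σ => hc σ trivial, rfl⟩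
  · rintro ⟨c, hc, rfl⟩
    exact ⟨c, fun σ _ => P.cochainProj_eq_self_iff.mp hc σ, rfl⟩

/-- The connecting isomorphism is bigraded. -/
theorem exists_bigraded_connecting_equiv (P : BigradedProj k d 𝓜) (P' : BigradedProj k d 𝓝)
    {g : PolyS k d} {a b : ℤ} (hgd : g ∈ gradeS k d a b)
    (hg : IsSMulRegular M g) {π : M →ₗ[PolyS k d] N}
    (hπ : Function.Surjective π) (hker : ∀ m, π m = 0 ↔ ∃ m', g • m' = m)
    (hP : ∀ p q m, π (P.proj p q m) = P'.proj p q (π m)) (i : ℕ)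
    (hM : ∀ c : CechCochain (xS k d) M i, cechD (xS k d) M i c = 0 → c ∈ cechB (xS k d) M i) :
    ∃ e : LocalCoh k d N i ≃ₗ[PolyS k d]
        Submodule.torsionBy (PolyS k d) (LocalCoh k d M (i + 1)) g,
      ∀ p q n, n ∈ gradeLocalCoh N 𝓝 i p q ↔
        (e n : LocalCoh k d M (i + 1)) ∈ gradeLocalCoh M 𝓜 (i + 1) (p - a) (q - b) := by
  obtain ⟨e, he⟩ := exists_connecting_equiv (xS k d) hg hπ hker i hM
  refine ⟨e, fun p q n => ?_⟩
  have hpg : ∀ z : CechCochain (xS k d) M (i + 1),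
      P.cochainProj (i + 1) p q (g • z) = g • P.cochainProj (i + 1) (p - a) (q - b) z := by
    intro z
    have h := P.cochainProj_smul (i + 1) hgd (p - a) (q - b) z
    rwa [sub_add_cancel, sub_add_cancel] at h
  have hπg : ∀ m, π (g • m) = 0 := fun m => (hker _).mpr ⟨m, rfl⟩
  rw [P'.mem_gradeLocalCoh_iff, P.mem_gradeLocalCoh_iff]
  constructor
  · rintro ⟨⟨c', hc'⟩, hPc, rfl⟩
    obtain ⟨c₀, hc₀⟩ := cechMap_surjective (xS k d) i hπ c'
    -- An arbitrary lift is made homogeneous by projecting it; then `g • z = δc` forces `z` into the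
    -- degree lowered by that of `g`.
    have hc : cechMap (xS k d) i π (P.cochainProj i p q c₀) = c' := by
      rw [P.cechMap_cochainProj P' hP, hc₀]; exact hPc
    set c := P.cochainProj i p q c₀ with hcdef
    subst hc
    have h1 : cechMap (xS k d) (i + 1) π (cechD (xS k d) M i c) = 0 := by
      rw [← cechD_cechMap]; exact hc'
    obtain ⟨z, hz⟩ := exists_smul_of_cechMap_eq_zero (xS k d) (fun m => (hker m).mp) h1
    have hzZ : z ∈ cechZ (xS k d) M (i + 1) := by
      rw [LinearMap.mem_ker]
      refine cechCochain_smul_injective (xS k d) _ hg ?_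
      rw [← map_smul, hz, cechD_cechD, smul_zero]
    refine ⟨⟨z, hzZ⟩, ?_, (he c z hz.symm hzZ hc').symm⟩
    refine cechCochain_smul_injective (xS k d) _ hg ?_
    change g • P.cochainProj (i + 1) (p - a) (q - b) z = g • z
    rw [← hpg, hz, ← P.cechD_cochainProj, hcdef, P.cochainProj_cochainProj]
  · rintro ⟨⟨z, hzZ⟩, hPz, hz⟩
    have hgz : g • z ∈ cechB (xS k d) M (i + 1) := by
      have h1 := (e n).2
      rw [Submodule.mem_torsionBy_iff, ← hz, ← map_smul, cechClass_eq_zero_iff] at h1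
      exact h1
    obtain ⟨c₀, hc₀⟩ := hgz
    have hc : cechD (xS k d) M i (P.cochainProj i p q c₀) = g • z := by
      rw [P.cechD_cochainProj, hc₀, hpg]
      exact congrArg (g • ·) hPz
    have hcZ : cechMap (xS k d) i π (P.cochainProj i p q c₀) ∈ cechZ (xS k d) N i := by
      rw [LinearMap.mem_ker, cechD_cechMap, hc, cechMap_smul_eq_zero (xS k d) _ hπg]
    refine ⟨⟨_, hcZ⟩, ?_, ?_⟩
    · have h2 : P'.cochainProj i p q (cechMap (xS k d) i π (P.cochainProj i p q c₀)) =
          cechMap (xS k d) i π (P.cochainProj i p q c₀) := by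
        rw [P.cechMap_cochainProj P' hP, P'.cochainProj_cochainProj]
      exact h2
    · refine e.injective (Subtype.ext ?_)
      rw [he _ z hc hzZ hcZ, hz]

end ConnectingGraded

/-! ### Presentation of `Sym(I)` and its map to the Rees algebra. -/

section SymmetricAlgebra

variable {k : Type*} [Field k] {d : ℕ} {f : Fin (d + 1) → PolyR k d}
  {φ : Matrix (Fin (d + 1)) (Fin d) (PolyR k d)} {νs : Fin d → ℕ}

theorem linearCombination_mem_idealI (f c : Fin (d + 1) → PolyR k d) :
    Fintype.linearCombination (PolyR k d) f c ∈ idealI f := by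
  rw [Fintype.linearCombination_apply]
  exact sum_mem fun i _ => Submodule.smul_mem _ _ (Ideal.subset_span (Set.mem_range_self i))

/-- The map `R^{d+1} → I` given by the generators. -/
def genMap (f : Fin (d + 1) → PolyR k d) : (Fin (d + 1) → PolyR k d) →ₗ[PolyR k d] idealI f :=
  (Fintype.linearCombination (PolyR k d) f).codRestrict (idealI f) (linearCombination_mem_idealI f)

theorem coe_genMap (f c : Fin (d + 1) → PolyR k d) :
    (genMap f c : PolyR k d) = Fintype.linearCombination (PolyR k d) f c := rfl

theorem genMap_surjective (f : Fin (d + 1) → PolyR k d) : Function.Surjective (genMap f) := by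
  rintro ⟨y, hy⟩
  obtain ⟨c, hc⟩ := (Submodule.mem_span_range_iff_exists_fun _).mp hy
  exact ⟨c, Subtype.ext hc⟩

theorem genMap_single (f : Fin (d + 1) → PolyR k d) (i : Fin (d + 1)) :
    genMap f (Pi.single i 1) = ⟨f i, Ideal.subset_span (Set.mem_range_self i)⟩ := by
  refine Subtype.ext ?_
  rw [coe_genMap, Fintype.linearCombination_apply_single, one_smul]

theorem betaMap_linearForm (f c : Fin (d + 1) → PolyR k d) :
    betaMap f (linearForm c) = SymmetricAlgebra.ι (PolyR k d) (idealI f) (genMap f c) := by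
  have h : genMap f c =
      ∑ i, c i • (⟨f i, Ideal.subset_span (Set.mem_range_self i)⟩ : idealI f) := by
    refine Subtype.ext ?_
    rw [coe_genMap, Fintype.linearCombination_apply, AddSubmonoidClass.coe_finsetSum]
    rfl
  rw [h, linearForm, map_sum, map_sum]
  refine Finset.sum_congr rfl fun i _ => ?_
  rw [map_mul, betaMap, MvPolynomial.aeval_X, MvPolynomial.aeval_C, map_smul, Algebra.smul_def]

theorem betaMap_surjective (f : Fin (d + 1) → PolyR k d) : Function.Surjective (betaMap f) := by
  intro z
  induction z using SymmetricAlgebra.induction with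
  | algebraMap r => exact ⟨MvPolynomial.C r, MvPolynomial.aeval_C _ r⟩
  | ι y =>
    obtain ⟨c, rfl⟩ := genMap_surjective f y
    exact ⟨linearForm c, betaMap_linearForm f c⟩
  | mul a b ha hb =>
    obtain ⟨s, rfl⟩ := ha
    obtain ⟨t, rfl⟩ := hb
    exact ⟨s * t, map_mul _ s t⟩
  | add a b ha hb =>
    obtain ⟨s, rfl⟩ := ha
    obtain ⟨t, rfl⟩ := hb
    exact ⟨s + t, map_add _ s t⟩

theorem betaMap_gOf (hφ : IsHilbertBurch f φ νs) (j : Fin d) : betaMap f (gOf φ j) = 0 := by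
  have h1 : Fintype.linearCombination (PolyR k d) f (φ.mulVecLin (Pi.single j 1)) = 0 :=
    (hφ.exact _).mpr ⟨_, rfl⟩
  rw [Matrix.mulVecLin_apply, Matrix.mulVec_single_one] at h1
  have h2 : genMap f (φ.col j) = 0 := Subtype.ext h1
  change betaMap f (linearForm (φ.col j)) = 0
  rw [betaMap_linearForm, h2, map_zero]

/-- A map out of `S` that kills the linear relations of `f` factors through `Sym(I)`. -/
theorem eq_zero_of_betaMap_eq_zero {B : Type*} [CommRing B] [Algebra (PolyR k d) B]
    (q : PolyS k d →ₐ[PolyR k d] B)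
    (hq : ∀ c, Fintype.linearCombination (PolyR k d) f c = 0 → q (linearForm c) = 0)
    {s : PolyS k d} (hs : betaMap f s = 0) : q s = 0 := by
  let v : (Fin (d + 1) → PolyR k d) →ₗ[PolyR k d] B :=
    Fintype.linearCombination (PolyR k d) fun i => q (MvPolynomial.X i)
  have hv : ∀ c, v c = q (linearForm c) := by
    intro c
    rw [linearForm, map_sum, Fintype.linearCombination_apply]
    refine Finset.sum_congr rfl fun i _ => ?_
    rw [MvPolynomial.C_mul', map_smul]
  have hk : LinearMap.ker (genMap f) ≤ LinearMap.ker v := by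
    intro c hc
    rw [LinearMap.mem_ker, hv]
    exact hq c (congrArg Subtype.val hc)
  let L : idealI f →ₗ[PolyR k d] B := (LinearMap.ker (genMap f)).liftQ v hk ∘ₗ
    ((genMap f).quotKerEquivOfSurjective (genMap_surjective f)).symm.toLinearMap
  have hL : ∀ c, L (genMap f c) = v c := by
    intro c
    have h1 : ((genMap f).quotKerEquivOfSurjective (genMap_surjective f)).symm (genMap f c) =
        Submodule.Quotient.mk c := by
      rw [LinearEquiv.symm_apply_eq]; rfl
    change (LinearMap.ker (genMap f)).liftQ v hk
      (((genMap f).quotKerEquivOfSurjective (genMap_surjective f)).symm (genMap f c)) = _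
    rw [h1]; rfl
  have hcomp : (SymmetricAlgebra.lift L).comp (betaMap f) = q := by
    refine MvPolynomial.algHom_ext fun i => ?_
    rw [AlgHom.comp_apply, betaMap, MvPolynomial.aeval_X, SymmetricAlgebra.lift_ι_apply,
      ← genMap_single, hL, Fintype.linearCombination_apply_single, one_smul]
  rw [← hcomp, AlgHom.comp_apply, hs, map_zero]

/-- `Sym(I) = S/(g_1, …, g_d)`. -/
theorem betaMap_eq_zero_iff (hφ : IsHilbertBurch f φ νs) (s : PolyS k d) :
    betaMap f s = 0 ↔ s ∈ gIdeal φ d := by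
  constructor
  · intro hs
    rw [← Ideal.Quotient.eq_zero_iff_mem]
    refine eq_zero_of_betaMap_eq_zero (B := PolyS k d ⧸ gIdeal φ d)
      (Ideal.Quotient.mkₐ (PolyR k d) (gIdeal φ d)) (fun c hc => ?_) hs
    exact Ideal.Quotient.eq_zero_iff_mem.mpr (linearForm_mem_gIdeal hφ hc)
  · intro hs
    have h : gIdeal φ d ≤ RingHom.ker (betaMap f) := by
      rw [gIdeal, Ideal.span_le]
      rintro _ ⟨j, -, rfl⟩
      exact betaMap_gOf hφ j
    exact h hs

theorem coe_symToRees_betaMap (f : Fin (d + 1) → PolyR k d) (s : PolyS k d) :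
    (symToRees (idealI f) (betaMap f s) : Polynomial (PolyR k d)) = reesEval f s := by
  have h : (reesAlgebra (idealI f)).val.comp ((symToRees (idealI f)).comp (betaMap f)) =
      reesEval f := by
    refine MvPolynomial.algHom_ext fun i => ?_
    rw [AlgHom.comp_apply, AlgHom.comp_apply, betaMap, MvPolynomial.aeval_X, symToRees,
      SymmetricAlgebra.lift_ι_apply, reesEval, MvPolynomial.aeval_X]
    exact (Polynomial.C_mul_X_eq_monomial).symm
  exact DFunLike.congr_fun h s

theorem symToRees_betaMap_eq_zero_iff (f : Fin (d + 1) → PolyR k d) (s : PolyS k d) :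
    symToRees (idealI f) (betaMap f s) = 0 ↔ reesEval f s = 0 := by
  rw [← coe_symToRees_betaMap, ZeroMemClass.coe_eq_zero]

end SymmetricAlgebra

/-! ### Zeroth Čech cohomology as torsion. -/

section ZerothCohomology

variable {ι : Type*} [LinearOrder ι] {A : Type*} [CommRing A] (x : ι → A)
  (M : Type*) [AddCommGroup M] [Module A M]

/-- The cochain of degree `0` given by an element of the module. -/
def constCochain : M →ₗ[A] CechCochain x M 0 :=
  LinearMap.pi fun σ => LocalizedModule.mkLinearMap (cechSubmonoid x σ.1) M

variable {M}

theorem constCochain_apply (m : M) (σ : {σ : Finset ι // σ.card = 0}) :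
    constCochain x M m σ = LocalizedModule.mk m 1 := rfl

theorem eq_one_of_mem_cechSubmonoid_empty (s : cechSubmonoid x ∅) : s = 1 := by
  obtain ⟨s, hs⟩ := s
  rw [cechSubmonoid, Finset.coe_empty, Set.image_empty, Submonoid.closure_empty,
    Submonoid.mem_bot] at hs
  exact Subtype.ext hs

theorem constCochain_injective : Function.Injective (constCochain x M) := by
  intro m m' h
  have h1 := congrFun h ⟨∅, rfl⟩
  rw [constCochain_apply, constCochain_apply, LocalizedModule.mk_eq] at h1
  obtain ⟨u, hu⟩ := h1
  rwa [eq_one_of_mem_cechSubmonoid_empty x u, one_smul, one_smul, one_smul, one_smul] at hu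

theorem constCochain_surjective : Function.Surjective (constCochain x M) := by
  intro c
  obtain ⟨⟨m, s⟩, hm⟩ : ∃ y : M × cechSubmonoid x ∅, LocalizedModule.mk y.1 y.2 = c ⟨∅, rfl⟩ := by
    induction h : c ⟨∅, rfl⟩ using LocalizedModule.induction_on with
    | h m s => exact ⟨(m, s), rfl⟩
  refine ⟨m, funext fun σ => ?_⟩
  obtain ⟨σ, hσ⟩ := σ
  obtain rfl := Finset.card_eq_zero.mp hσ
  rw [constCochain_apply, ← eq_one_of_mem_cechSubmonoid_empty x s]
  exact hm

/-- The cocycles of degree `0` are the elements killed by powers of every `x_j`. -/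
theorem cechD_constCochain_eq_zero_iff (m : M) :
    cechD x M 0 (constCochain x M m) = 0 ↔ ∀ j, ∃ n : ℕ, x j ^ n • m = 0 := by
  constructor
  · intro h j
    obtain ⟨n, hn⟩ := exists_pow_smul_eq_zero_of_cechD_zero x j h
    exact ⟨n, constCochain_injective x (by rw [map_smul, hn, map_zero])⟩
  · intro h
    funext τ
    obtain ⟨τ, hτ⟩ := τ
    obtain ⟨j, rfl⟩ := Finset.card_eq_one.mp hτ
    obtain ⟨n, hn⟩ := h j
    have h1 : LocalizedModule.mk m (1 : cechSubmonoid x {j}) = 0 := by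
      rw [← LocalizedModule.zero_mk 1, LocalizedModule.mk_eq]
      refine ⟨⟨x j ^ n, pow_mem (Submonoid.subset_closure (Set.mem_image_of_mem x (by simp))) n⟩, ?_⟩
      rw [one_smul, one_smul, smul_zero]
      exact hn
    rw [cechD_apply, Finset.sum_singleton]
    change _ • cechPush x _ {j} (Finset.erase {j} j) = 0
    rw [Finset.erase_singleton, cechPush,
      dif_pos (⟨rfl, Finset.empty_subset _⟩ : (∅ : Finset ι).card = 0 ∧
        (∅ : Finset ι) ⊆ {j}),
      constCochain_apply, cechRes_mk]
    exact (congrArg _ h1).trans (smul_zero _)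

theorem BigradedProj.cochainProj_constCochain {k : Type*} [Field k] {d : ℕ} {M : Type*}
    [AddCommGroup M] [Module (PolyS k d) M] {𝓜 : ℤ → ℤ → AddSubgroup M} (P : BigradedProj k d 𝓜)
    (p q : ℤ) (m : M) : P.cochainProj 0 p q (constCochain (xS k d) M m) =
      constCochain (xS k d) M (P.proj p q m) := by
  funext σ
  rw [constCochain_apply]
  change P.locProj σ.1 p q (LocalizedModule.mk m 1) = _
  rw [P.locProj_mk, cechDeg_one, add_zero]

theorem BigradedProj.mem_iff {k : Type*} [Field k] {d : ℕ} {M : Type*}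
    [AddCommGroup M] [Module (PolyS k d) M] {𝓜 : ℤ → ℤ → AddSubgroup M} (P : BigradedProj k d 𝓜)
    {p q : ℤ} {m : M} : m ∈ 𝓜 p q ↔ P.proj p q m = m :=
  ⟨P.proj_of_mem, fun h => h ▸ P.proj_mem p q m⟩

theorem BigradedProj.cechClass_constCochain_mem_iff {k : Type*} [Field k] {d : ℕ} {M : Type*}
    [AddCommGroup M] [Module (PolyS k d) M] {𝓜 : ℤ → ℤ → AddSubgroup M} (P : BigradedProj k d 𝓜)
    {p q : ℤ} {m : M} (hm : constCochain (xS k d) M m ∈ cechZ (xS k d) M 0) :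
    cechClass (xS k d) M 0 ⟨_, hm⟩ ∈ gradeLocalCoh M 𝓜 0 p q ↔ m ∈ 𝓜 p q := by
  rw [P.mem_gradeLocalCoh_iff, P.mem_iff]
  constructor
  · rintro ⟨c, hc, h⟩
    rw [← sub_eq_zero, ← map_sub, cechClass_eq_zero_iff] at h
    have h0 : (c : CechCochain (xS k d) M 0) - constCochain (xS k d) M m = 0 := h
    rw [sub_eq_zero.mp h0, P.cochainProj_constCochain] at hc
    exact constCochain_injective _ hc
  · intro h
    refine ⟨⟨_, hm⟩, ?_, rfl⟩
    have h1 := P.cochainProj_constCochain p q m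
    rwa [h] at h1

end ZerothCohomology

/-! ### Identification of `𝓚` and assembly of the isomorphism. -/

section Kernel

variable {k : Type*} [Field k] {d : ℕ} {f : Fin (d + 1) → PolyR k d}
  {φ : Matrix (Fin (d + 1)) (Fin d) (PolyR k d)} {νs : Fin d → ℕ}

/-- The map `ker (S → 𝓡(I)) → 𝓚` induced by `β`. -/
def kerMap (f : Fin (d + 1) → PolyR k d) : RingHom.ker (reesEval f) →ₗ[PolyS k d] KerK f where
  toFun s := ⟨betaMap f s, (symToRees_betaMap_eq_zero_iff f s).mpr s.2⟩
  map_add' s t := Subtype.ext (map_add (betaMap f) s.1 t.1)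
  map_smul' a s := Subtype.ext (map_mul (betaMap f) a s.1)

theorem incl_kerMap (s : RingHom.ker (reesEval f)) : KerK.incl f (kerMap f s) = betaMap f s := rfl

theorem incl_injective (f : Fin (d + 1) → PolyR k d) : Function.Injective (KerK.incl f) :=
  Subtype.val_injective

theorem kerMap_surjective (f : Fin (d + 1) → PolyR k d) : Function.Surjective (kerMap f) := by
  rintro ⟨z, hz⟩
  obtain ⟨s, rfl⟩ := betaMap_surjective f z
  exact ⟨⟨s, (symToRees_betaMap_eq_zero_iff f s).mp hz⟩, rfl⟩

/-- Linear type away from `𝔪` makes the kernel torsion. Conversely, one variable suffices: if `x_0 ^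
n * s` dies in `Sym(I)`, it dies in the domain `R[t]`, where `x_0` is nonzero. -/
theorem constCochain_mem_cechZ_iff (hφ : IsHilbertBurch f φ νs) (hG : SatisfiesG (idealI f))
    (hd : 0 < d) (s : PolyS k d) :
    constCochain (xS k d) (PolyS k d ⧸ gIdeal φ d) (Ideal.Quotient.mk _ s) ∈ cechZ _ _ 0 ↔
      reesEval f s = 0 := by
  rw [LinearMap.mem_ker, cechD_constCochain_eq_zero_iff]
  have hiff : ∀ j (n : ℕ), (xS k d j ^ n • (Ideal.Quotient.mk (gIdeal φ d) s) = 0 ↔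
      xS k d j ^ n * s ∈ gIdeal φ d) := fun j n => Ideal.Quotient.eq_zero_iff_mem
  constructor
  · intro h
    obtain ⟨n, hn⟩ := h ⟨0, hd⟩
    rw [hiff, ← betaMap_eq_zero_iff hφ] at hn
    have h1 : reesEval f (xS k d ⟨0, hd⟩ ^ n * s) = 0 := by
      rw [← symToRees_betaMap_eq_zero_iff, hn, map_zero]
    rw [map_mul, map_pow, xS, reesEval, MvPolynomial.aeval_C] at h1
    refine (mul_eq_zero.mp h1).resolve_left (pow_ne_zero _ ?_)
    rw [Polynomial.algebraMap_apply]
    exact Polynomial.C_ne_zero.mpr (MvPolynomial.X_ne_zero _)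
  · intro h j
    obtain ⟨n, hn⟩ := exists_pow_mul_mem_gIdeal hφ hG h j
    exact ⟨n, (hiff j n).mpr hn⟩

/-- `𝓚 = H⁰_𝔪(Sym(I))`. -/
theorem exists_bigraded_equiv_localCoh_zero (hφ : IsHilbertBurch f φ νs)
    (hG : SatisfiesG (idealI f)) (hd : 0 < d) :
    ∃ e : KerK f ≃ₗ[PolyS k d] LocalCoh k d (PolyS k d ⧸ gIdeal φ d) 0,
      ∀ p q κ, κ ∈ gradeK f p q ↔ e κ ∈ gradeLocalCoh _ (gradeQuot (gIdeal φ d)) 0 p q := by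
  let C := PolyS k d ⧸ gIdeal φ d
  let v : RingHom.ker (reesEval f) →ₗ[PolyS k d] LocalCoh k d C 0 :=
    cechClass (xS k d) C 0 ∘ₗ LinearMap.codRestrict (cechZ (xS k d) C 0)
      (constCochain (xS k d) C ∘ₗ (gIdeal φ d).mkQ ∘ₗ (RingHom.ker (reesEval f)).subtype)
      fun s => (constCochain_mem_cechZ_iff hφ hG hd s.1).mpr s.2
  have hv : Function.Surjective v := by
    intro w
    obtain ⟨⟨c, hc⟩, rfl⟩ := cechClass_surjective _ _ w
    obtain ⟨m, rfl⟩ := constCochain_surjective _ c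
    obtain ⟨s, rfl⟩ := Ideal.Quotient.mk_surjective m
    exact ⟨⟨s, (constCochain_mem_cechZ_iff hφ hG hd s).mp hc⟩, rfl⟩
  have hker : LinearMap.ker (kerMap f) = LinearMap.ker v := by
    ext s
    have h1 : kerMap f s = 0 ↔ (s : PolyS k d) ∈ gIdeal φ d := by
      rw [← betaMap_eq_zero_iff hφ, ← incl_kerMap, map_eq_zero_iff _ (incl_injective f)]
    have h2 : v s = 0 ↔ (s : PolyS k d) ∈ gIdeal φ d := by
      rw [← Ideal.Quotient.eq_zero_iff_mem,
        ← map_eq_zero_iff (constCochain (xS k d) C) (constCochain_injective _)]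
      exact cechClass_eq_zero_iff _ _
    rw [LinearMap.mem_ker, LinearMap.mem_ker, h1, h2]
  obtain ⟨e, he⟩ := exists_linearEquiv_of_ker_eq (A := PolyS k d)
    (E := RingHom.ker (reesEval f)) (kerMap f) v (kerMap_surjective f) hv hker
  refine ⟨e, fun p q κ => ?_⟩
  obtain ⟨s, rfl⟩ := kerMap_surjective f κ
  rw [he]
  refine Iff.trans ?_ ((quotProj (gIdeal φ d) fun s hs p q =>
    gradeProj_mem_gIdeal hφ.homogeneous d hs p q).cechClass_constCochain_mem_iff
      ((constCochain_mem_cechZ_iff hφ hG hd s.1).mpr s.2)).symm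
  -- A homogeneous representative is the same thing on both sides, since both gradings are induced
  -- from `S` through quotients by the same ideal.
  have hiff : ∀ t, betaMap f t = betaMap f s.1 ↔
      Ideal.Quotient.mk (gIdeal φ d) t = Ideal.Quotient.mk (gIdeal φ d) s.1 := by
    intro t
    rw [← sub_eq_zero, ← map_sub, betaMap_eq_zero_iff hφ, Ideal.Quotient.eq]
  constructor
  · rintro ⟨t, ht, h⟩
    exact ⟨t, ht, (hiff t).mp h⟩
  · rintro ⟨t, ht, h⟩
    exact ⟨t, ht, (hiff t).mpr h⟩

/-- The bound `i + r < d` is exactly what makes `Hⁱ_𝔪(A_r)` vanish, so that the connecting map is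
injective. -/
theorem exists_bigraded_gProj_equiv (hφ : IsHilbertBurch f φ νs) (hG : SatisfiesG (idealI f))
    {r i : ℕ} (hr : r < d) (hi : i + r < d) :
    ∃ e : LocalCoh k d (PolyS k d ⧸ gIdeal φ (r + 1)) i ≃ₗ[PolyS k d]
        Submodule.torsionBy (PolyS k d) (LocalCoh k d (PolyS k d ⧸ gIdeal φ r) (i + 1))
          (gOf φ ⟨r, hr⟩),
      ∀ p q n, n ∈ gradeLocalCoh _ (gradeQuot (gIdeal φ (r + 1))) i p q ↔
        (e n : LocalCoh k d (PolyS k d ⧸ gIdeal φ r) (i + 1)) ∈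
          gradeLocalCoh _ (gradeQuot (gIdeal φ r)) (i + 1) (p - 1) (q - νs ⟨r, hr⟩) := by
  refine exists_bigraded_connecting_equiv
    (quotProj (gIdeal φ r) fun s hs p q => gradeProj_mem_gIdeal hφ.homogeneous r hs p q)
    (quotProj (gIdeal φ (r + 1)) fun s hs p q => gradeProj_mem_gIdeal hφ.homogeneous _ hs p q)
    (gOf_mem_gradeS fun l => hφ.homogeneous l ⟨r, hr⟩) (isSMulRegular_gOf hφ hG r hr)
    (gProj_surjective φ r) (gProj_eq_zero_iff φ hr) ?_ i ?_
  · intro p q m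
    obtain ⟨s, rfl⟩ := Ideal.Quotient.mk_surjective m
    rfl
  · exact cechVanish_quotient_gIdeal (xS k d) φ hr.le
      (fun j hj => isSMulRegular_gOf hφ hG j (hj.trans hr)) (n := i + 1)
      (fun l hl => cechVanish_polyS k d l (by omega)) i (Nat.lt_succ_self i)

theorem bigradedIso_gradeK (hφ : IsHilbertBurch f φ νs) (hG : SatisfiesG (idealI f)) {r : ℕ}
    (hr : r + 2 = d) :
    BigradedIso k d (gradeK f)
      (gradeSub
        (shift (gradeLocalCoh (PolyS k d ⧸ gIdeal φ r) (gradeQuot (gIdeal φ r)) 2)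
          (-2) (-(νs ⟨r + 1, by omega⟩ : ℤ) - (νs ⟨r, by omega⟩ : ℤ)))
        (annihilatedBy (LocalCoh k d (PolyS k d ⧸ gIdeal φ r) 2)
          (gOf φ ⟨r, by omega⟩) (gOf φ ⟨r + 1, by omega⟩))) := by
  obtain ⟨e₀, he₀⟩ := exists_bigraded_equiv_localCoh_zero hφ hG (by omega)
  obtain ⟨e₁, he₁⟩ := exists_bigraded_gProj_equiv hφ hG (r := r + 1) (i := 0) (by omega) (by omega)
  obtain ⟨e₂, he₂⟩ := exists_bigraded_gProj_equiv hφ hG (r := r) (i := 1) (by omega) (by omega)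
  subst hr
  let F : KerK f →ₗ[PolyS k (r + 2)] LocalCoh k (r + 2) (PolyS k (r + 2) ⧸ gIdeal φ r) 2 :=
    (Submodule.subtype _ ∘ₗ e₂.toLinearMap) ∘ₗ (Submodule.subtype _ ∘ₗ e₁.toLinearMap) ∘ₗ
      e₀.toLinearMap
  have hF : ∀ κ, F κ = e₂ (e₁ (e₀ κ)) := fun κ => rfl
  have hinj : Function.Injective F := (Subtype.val_injective.comp e₂.injective).comp
    ((Subtype.val_injective.comp e₁.injective).comp e₀.injective)
  have hrange : LinearMap.range F = annihilatedBy
      (LocalCoh k (r + 2) (PolyS k (r + 2) ⧸ gIdeal φ r) 2)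
      (gOf φ ⟨r, by omega⟩) (gOf φ ⟨r + 1, by omega⟩) := by
    ext w
    rw [annihilatedBy, Submodule.mem_inf]
    constructor
    · rintro ⟨κ, rfl⟩
      refine ⟨(e₂ _).2, ?_⟩
      rw [Submodule.mem_torsionBy_iff, hF, ← Submodule.coe_smul, ← map_smul,
        (Submodule.mem_torsionBy_iff _ _).mp (e₁ (e₀ κ)).2, map_zero, ZeroMemClass.coe_zero]
    · rintro ⟨h1, h2⟩
      obtain ⟨y, hy⟩ := e₂.surjective ⟨w, h1⟩
      -- The map `e₂` is `S`-linear and injective, so being killed by the last form can be tested in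
      -- `H²`.
      have hy' : y ∈ Submodule.torsionBy (PolyS k (r + 2)) _ (gOf φ ⟨r + 1, by omega⟩) := by
        rw [Submodule.mem_torsionBy_iff] at h2 ⊢
        refine e₂.injective ?_
        rw [map_smul, hy, map_zero]
        exact Subtype.ext h2
      obtain ⟨z, hz⟩ := e₁.surjective ⟨y, hy'⟩
      obtain ⟨κ, hκ⟩ := e₀.surjective z
      exact ⟨κ, by rw [hF, hκ, hz, hy]⟩
  refine ⟨LinearEquiv.ofInjective F hinj ≪≫ₗ LinearEquiv.ofEq _ _ hrange, fun p q κ => ?_⟩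
  -- The two connecting maps lower the `T`-degree by one each and the `x`-degree by the degrees of
  -- the last two columns.
  have h1 : p + -2 = p - 1 - 1 := by ring
  change _ ↔ F κ ∈ gradeLocalCoh _ (gradeQuot (gIdeal φ r)) 2 (p + -2)
    (q + (-(νs ⟨r + 1, by omega⟩ : ℤ) - (νs ⟨r, by omega⟩ : ℤ)))
  rw [h1, ← add_sub_assoc, ← sub_eq_add_neg, hF, he₀, he₁, he₂]

end Kernel

end

end ReesSym

open ReesSym in
theorem theoremD {k : Type*} [Field k] [CharZero k] {d : ℕ} (hd : 3 ≤ d) (ν : ℕ)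
    (f : Fin (d + 1) → PolyR k d) (hf : ∀ i, (f i).IsHomogeneous ν)
    (hmin : ∀ i, f i ∉ Ideal.span (f '' {i}ᶜ))
    (hht : (idealI f).height = 2) (hperf : IsPerfectIdeal (idealI f))
    (hG : SatisfiesG (idealI f))
    (φ : Matrix (Fin (d + 1)) (Fin d) (PolyR k d)) (νs : Fin d → ℕ)
    (hφ : IsHilbertBurch f φ νs) :
    BigradedIso k d (gradeK f)
      (gradeSub
        (shift (gradeLocalCoh (PolyS k d ⧸ gIdeal φ (d - 2)) (gradeQuot (gIdeal φ (d - 2))) 2)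
          (-2) (-(νs ⟨d - 1, by omega⟩ : ℤ) - (νs ⟨d - 2, by omega⟩ : ℤ)))
        (annihilatedBy (LocalCoh k d (PolyS k d ⧸ gIdeal φ (d - 2)) 2)
          (gOf φ ⟨d - 2, by omega⟩) (gOf φ ⟨d - 1, by omega⟩))) := by
  have h := bigradedIso_gradeK hφ hG (r := d - 2) (by omega)
  have h1 : (⟨d - 2 + 1, by omega⟩ : Fin d) = ⟨d - 1, by omega⟩ :=
    Fin.ext (show d - 2 + 1 = d - 1 by omega)
  rwa [h1] at h
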